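/- Let $(\Omega,\mathcal F,\mathbf P)$ be a probability space, let $H_1,H_2\in(0,1)$, and let $X=\{X(\mathbf t),\ \mathbf t=(t_1,t_2)\in[0,\infty)^2\}$ be a centered real Gaussian random field that is normalized by $\mathbf E X^2(1,1)=1$ and satisfies the following, where $\stackrel{d}{=}$ is equality of finite-dimensional distributions. * Self-similarity with index $(H_1,H_2)$: for all $a_1,a_2>0$, $\{X(a_1t_1,a_2t_2)\}_{\mathbf t\in[0,\infty)^2}\stackrel{d}{=}\{a_1^{H_1}a_2^{H_2}X(\mathbf t)\}_{\mathbf t\in[0,\infty)^2}$. * Stationary rectangular increments: for all $\mathbf u\in[0,\infty)^2$, $\{\Delta_{\mathbf u}X(\mathbf u+\mathbf h)\}_{\mathbf h\in[0,\infty)^2}\stackrel{d}{=}\{\Delta_{\mathbf 0}X(\mathbf h)\}_{\mathbf h\in[0,\infty)^2}$, where $\Delta_{\mathbf u}X(\mathbf v)=X(v_1,v_2)-X(u_1,v_2)-X(v_1,u_2)+X(u_1,u_2)$. * Separability on $[1,\infty)^2$: there are a countable $S\subset[1,\infty)^2$ and a null event outside of which, for each open $G$ and each $\mathbf t\in G\cap[1,\infty)^2$,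 $X(\mathbf t)$ lies in the closure of $\{X(\mathbf s):\mathbf s\in S\cap G\}$. Let $\varphi:(0,\infty)^2\to(0,\infty)$ be nondecreasing in each coordinate. Put $H=\min\{H_1,H_2\}$, $\eta=\max\{H_1,H_2\}$, $Q=\frac1{H_1}+\frac1{H_2}$, $$N_1=\Big(\frac{H_1+H_2}{H_2}\Big)^{1/H_1}+3,\quad N_2=\Big(\frac{H_1+H_2}{H_1}\Big)^{1/H_2}+3,$$ $$C_1=N_1N_2\exp\Big\{Q+\frac1{2(4^{H_1+H_2}+1)}\Big\},\quad C_2=\frac{3}{2\cdot4^{\eta}\,(3\cdot4^{H}+4^{1-H})}.$$ Assume that $$\Sigma:=\sum_{n=0}^\infty\sum_{m=0}^\infty \varphi^{2Q}(2^n,2^m)\exp\Big\{-2\,\frac{\varphi^2(2^n,2^m)}{\varphi^2(1,1)}\Big\}<\infty .$$ Then for every $$\varepsilon>\frac{2}{\varphi(1,1)}\sqrt{\frac{2}{3\cdot4^{\eta}}\,\big(3\cdot4^{H}+4^{1-H}\big)}$$ one has $$\mathbf P\Big\{\sup_{\mathbf t\in[1,\infty)^2}\frac{|X(\mathbf t)|}{t_1^{H_1}t_2^{H_2}\varphi(\mathbf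 t)}>\varepsilon\Big\}\le C_1\,\varepsilon^{2Q}\exp\Big\{-\frac{\varepsilon^2}{2}\,\varphi^2(1,1)\,C_2\Big\}\;\Sigma .$$ -/

import Mathlib

open MeasureTheory ProbabilityTheory
open scoped NNReal

noncomputable section

namespace GaussField

/-- Equality of all finite-dimensional distributions of two real random fields. -/
def SameFDD {ι Ω : Type*} [MeasurableSpace Ω] (μ : Measure Ω) (X Y : ι → Ω → ℝ) : Prop :=
  ∀ I : Finset ι, μ.map (fun ω (i : I) => X i ω) = μ.map (fun ω (i : I) => Y i ω)

/-- Self-similarity with index `(H₁, H₂)` of a field on `[0, ∞)²`. -/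
def IsSelfSimilar {Ω : Type*} [MeasurableSpace Ω] (μ : Measure Ω)
    (X : ℝ≥0 × ℝ≥0 → Ω → ℝ) (H₁ H₂ : ℝ) : Prop :=
  ∀ a₁ a₂ : ℝ≥0, 0 < a₁ → 0 < a₂ →
    SameFDD μ (fun t ω => X (a₁ * t.1, a₂ * t.2) ω)
      (fun t ω => (a₁ : ℝ) ^ H₁ * (a₂ : ℝ) ^ H₂ * X t ω)

/-- The rectangular increment `Δ_u X(v)`. -/
def rectIncrement {Ω : Type*} (X : ℝ≥0 × ℝ≥0 → Ω → ℝ) (u v : ℝ≥0 × ℝ≥0) (ω : Ω) : ℝ :=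
  X (v.1, v.2) ω - X (u.1, v.2) ω - X (v.1, u.2) ω + X (u.1, u.2) ω

/-- Stationary rectangular increments: for each `u`, the fields `h ↦ Δ_u X(u + h)` and
`h ↦ Δ_0 X(h)` have the same finite-dimensional distributions. -/
def HasStationaryRectIncrements {Ω : Type*} [MeasurableSpace Ω] (μ : Measure Ω)
    (X : ℝ≥0 × ℝ≥0 → Ω → ℝ) : Prop :=
  ∀ u : ℝ≥0 × ℝ≥0,
    SameFDD μ (fun h ω => rectIncrement X u (u + h) ω) (fun h ω => rectIncrement X 0 h ω)

/-- Separability (in the sense of Doob) of the process `(X t)` for `t ∈ A`: there is a countable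
`S ⊆ A` such that, outside a null event, every value `X t ω` with `t` in a relatively open set
`A ∩ G` is in the closure of the values `X s ω`, `s ∈ S ∩ G`. -/
def IsSeparableOn {T Ω : Type*} [TopologicalSpace T] [MeasurableSpace Ω] (μ : Measure Ω)
    (X : T → Ω → ℝ) (A : Set T) : Prop :=
  ∃ S : Set T, S ⊆ A ∧ S.Countable ∧ ∀ᵐ ω ∂μ, ∀ G : Set T, IsOpen G → ∀ t ∈ A ∩ G,
    X t ω ∈ closure ((fun s => X s ω) '' (S ∩ G))

/-- `Q = 1 / H₁ + 1 / H₂`. -/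
def expQ (H₁ H₂ : ℝ) : ℝ := 1 / H₁ + 1 / H₂

/-- `N₁ = ((H₁ + H₂) / H₂) ^ (1 / H₁) + 3`. -/
def constN₁ (H₁ H₂ : ℝ) : ℝ := ((H₁ + H₂) / H₂) ^ (1 / H₁) + 3

/-- `N₂ = ((H₁ + H₂) / H₁) ^ (1 / H₂) + 3`. -/
def constN₂ (H₁ H₂ : ℝ) : ℝ := ((H₁ + H₂) / H₁) ^ (1 / H₂) + 3

/-- `C₁ = N₁ N₂ exp (Q + 1 / (2 (4 ^ (H₁ + H₂) + 1)))`. -/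
def constC₁ (H₁ H₂ : ℝ) : ℝ :=
  constN₁ H₁ H₂ * constN₂ H₁ H₂ *
    Real.exp (expQ H₁ H₂ + 1 / (2 * ((4 : ℝ) ^ (H₁ + H₂) + 1)))

/-- `C₂ = 3 / (2 · 4 ^ η (3 · 4 ^ H + 4 ^ (1 - H)))`, `H = min H₁ H₂`, `η = max H₁ H₂`. -/
def constC₂ (H₁ H₂ : ℝ) : ℝ :=
  3 / (2 * (4 : ℝ) ^ (max H₁ H₂) *
    (3 * (4 : ℝ) ^ (min H₁ H₂) + (4 : ℝ) ^ (1 - min H₁ H₂)))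

/-- The supremum over `[1, ∞)²` of `|X(t)| / (t₁ ^ H₁ t₂ ^ H₂ φ(t))`, possibly `+∞`. -/
def normalizedSup {Ω : Type*} (X : ℝ≥0 × ℝ≥0 → Ω → ℝ) (H₁ H₂ : ℝ) (φ : ℝ → ℝ → ℝ)
    (ω : Ω) : EReal :=
  ⨆ t ∈ Set.Ici ((1, 1) : ℝ≥0 × ℝ≥0),
    ((|X t ω| / ((t.1 : ℝ) ^ H₁ * (t.2 : ℝ) ^ H₂ * φ t.1 t.2) : ℝ) : EReal)

/-- `Y(ε)`, the probability that the normalized supremum exceeds `ε`. -/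
def tailY {Ω : Type*} [MeasurableSpace Ω] (μ : Measure Ω) (X : ℝ≥0 × ℝ≥0 → Ω → ℝ)
    (H₁ H₂ : ℝ) (φ : ℝ → ℝ → ℝ) (ε : ℝ) : ℝ :=
  μ.real {ω | (ε : EReal) < normalizedSup X H₁ H₂ φ ω}

/-- The `(n, m)` term `φ(2ⁿ, 2ᵐ) ^ (2Q) / exp (2 φ(2ⁿ, 2ᵐ)² / φ(1, 1)²)` of the double series. -/
def seriesTerm (H₁ H₂ : ℝ) (φ : ℝ → ℝ → ℝ) (k : ℕ × ℕ) : ℝ :=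
  φ (2 ^ k.1) (2 ^ k.2) ^ (2 * expQ H₁ H₂) /
    Real.exp (2 * (φ (2 ^ k.1) (2 ^ k.2) ^ 2 / φ 1 1 ^ 2))

end GaussField

end

/-! Self-similarity and the normalization give `X t` the standard deviation `fieldScale H₁ H₂ t`, so
dividing by it gives a field of unit variance. Self-similarity also forces `X` to vanish on the
axes. Hence increments along one coordinate are rectangular increments anchored on an axis, and
stationarity gives their variance. On a rectangle `[c, d]` with `d` about `2c`, the normalized field
is then Hölder in mean square with constants independent of the rectangle, and covering it at scale
`v` takes at most `N₁ N₂ / 4 · v ^ (-Q)` points (`integral_normalizedField_sub_sq_le`,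
`interval_net_card_le`).

Chaining turns this entropy bound into a Gaussian tail (`measure_exists_lt_abs_le_of_covering`).
Nets of mesh `p, p², …` are linked, Hölder's inequality with geometric weights separates the levels,
and the factor from the final finite set tends to 1. The choice `p = 2 / u²` gives `C₁ u ^ (2Q) exp
(-u² / 2)` (`entropy_bound_le`).

The quadrant is covered by dyadic blocks. On block `(n, m)` monotonicity allows the level `u = ε
φ(2ⁿ, 2ᵐ)`, and the lower bound on `ε` splits `u² / 2` into the exponent containing `C₂` plus that
of the series term (`exponent_bound`). Separability reduces each block to countably many points, and
a union bound over blocks finishes. -/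

namespace GaussField

/-! ### Exponential moments and chaining by Hölder's inequality -/

/-- Laplace transform bound for a centered Gaussian variable. -/
lemma lintegral_exp_mul_le_of_hasGaussianLaw {Ω : Type*} [MeasurableSpace Ω] {μ : Measure Ω}
    {Z : Ω → ℝ} (hZ : HasGaussianLaw Z μ) (h0 : ∫ ω, Z ω ∂μ = 0) {v : ℝ}
    (hv : ∫ ω, Z ω ^ 2 ∂μ ≤ v ^ 2) (c : ℝ) :
    ∫⁻ ω, ENNReal.ofReal (Real.exp (c * Z ω)) ∂μ ≤ ENNReal.ofReal (Real.exp (c ^ 2 * v ^ 2 / 2)) := by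
  have hmap := hZ.map_eq_gaussianReal
  have hint : Integrable (fun ω => Real.exp (c * Z ω)) μ := by
    have h := integrable_exp_mul_gaussianReal (μ := μ[Z]) (v := Var[Z; μ].toNNReal) c
    rw [← hmap] at h
    exact h.comp_aemeasurable hZ.aemeasurable
  rw [← ofReal_integral_eq_lintegral_ofReal hint (ae_of_all _ fun _ => (Real.exp_pos _).le)]
  apply ENNReal.ofReal_le_ofReal
  have h1 : ∫ ω, Real.exp (c * Z ω) ∂μ = mgf Z μ c := rfl
  rw [h1, mgf_gaussianReal hmap, h0, variance_of_integral_eq_zero hZ.aemeasurable h0,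
    Real.coe_toNNReal _ (integral_nonneg fun _ => sq_nonneg _)]
  apply Real.exp_le_exp.mpr
  nlinarith [sq_nonneg c]

/-- The increments of a chain: the value itself at level `0`, and the difference to the
projection on the preceding level afterwards. -/
def chainIncrement {T Ω : Type*} (Y : T → Ω → ℝ) (π : ℕ → T → T) : ℕ → T → Ω → ℝ
  | 0, t, ω => Y t ω
  | i + 1, t, ω => Y t ω - Y (π i t) ω

/-- The sum of the exponential moments of one level of the chain. -/
noncomputable def chainWeight {T Ω : Type*} (Y : T → Ω → ℝ) (π : ℕ → T → T) (A : ℕ → Finset T) (c : ℝ) (i : ℕ)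
    (ω : Ω) : ℝ :=
  ∑ s ∈ A i, (Real.exp (c * chainIncrement Y π i s ω) + Real.exp (-c * chainIncrement Y π i s ω))

lemma chainWeight_nonneg {T Ω : Type*} (Y : T → Ω → ℝ) (π : ℕ → T → T) (A : ℕ → Finset T) (c : ℝ)
    (i : ℕ) (ω : Ω) : 0 ≤ chainWeight Y π A c i ω :=
  Finset.sum_nonneg fun _ _ => by positivity

/-- The argument `l / w` is paired with the power `w` so that Hölder's inequality can later be
applied with exponents `w`. -/
lemma exp_abs_le_chainWeight_rpow {T Ω : Type*} (Y : T → Ω → ℝ) (π : ℕ → T → T)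
    (A : ℕ → Finset T) {l w : ℝ} (hl : 0 < l) (hw : 0 < w) {i : ℕ} {t : T} (ht : t ∈ A i) (ω : Ω) :
    Real.exp (l * |chainIncrement Y π i t ω|) ≤ chainWeight Y π A (l / w) i ω ^ w := by
  have h1 : Real.exp (l / w * |chainIncrement Y π i t ω|) ≤ chainWeight Y π A (l / w) i ω := by
    refine le_trans ?_ (Finset.single_le_sum (f := fun s =>
      Real.exp (l / w * chainIncrement Y π i s ω) + Real.exp (-(l / w) * chainIncrement Y π i s ω))
      (fun _ _ => by positivity) ht)
    rcases abs_choice (chainIncrement Y π i t ω) with h | h <;> rw [h]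
    · exact le_add_of_nonneg_right (Real.exp_pos _).le
    · rw [mul_neg, ← neg_mul]
      exact le_add_of_nonneg_left (Real.exp_pos _).le
  calc Real.exp (l * |chainIncrement Y π i t ω|)
      = Real.exp (l / w * |chainIncrement Y π i t ω|) ^ w := by
        rw [← Real.exp_mul]; congr 1; field_simp
    _ ≤ _ := Real.rpow_le_rpow (Real.exp_pos _).le h1 hw.le

/-- Telescoping along the chain from `t` down to level 0, with the triangle inequality at each link.
The right side does not depend on `t`, so it controls the maximum over the last level. -/
lemma exp_abs_le_prod_chainWeight {T Ω : Type*} (Y : T → Ω → ℝ) (π : ℕ → T → T)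
    (A : ℕ → Finset T) {l : ℝ} (hl : 0 < l) (w : ℕ → ℝ) (ω : Ω) (K : ℕ)
    (hw : ∀ i ≤ K, 0 < w i) (hπ : ∀ i < K, ∀ t ∈ A (i + 1), π i t ∈ A i) :
    ∀ t ∈ A K, Real.exp (l * |Y t ω|) ≤
      ∏ i ∈ Finset.range (K + 1), chainWeight Y π A (l / w i) i ω ^ w i := by
  induction K with
  | zero =>
    intro t ht
    simpa [chainIncrement] using exp_abs_le_chainWeight_rpow Y π A hl (hw 0 le_rfl) ht ω
  | succ K ih =>
    intro t ht
    have h1 := ih (fun i hi => hw i (by omega)) (fun i hi => hπ i (by omega)) (π K t)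
      (hπ K (by omega) t ht)
    have h2 := exp_abs_le_chainWeight_rpow Y π A hl (hw (K + 1) le_rfl) ht ω
    rw [Finset.prod_range_succ]
    calc Real.exp (l * |Y t ω|)
        ≤ Real.exp (l * |Y (π K t) ω|) * Real.exp (l * |chainIncrement Y π (K + 1) t ω|) := by
          rw [← Real.exp_add, ← mul_add]
          apply Real.exp_le_exp.mpr
          apply mul_le_mul_of_nonneg_left _ hl.le
          have := abs_add_le (Y (π K t) ω) (chainIncrement Y π (K + 1) t ω)
          simpa [chainIncrement] using this
      _ ≤ _ := mul_le_mul h1 h2 (Real.exp_pos _).le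
          (Finset.prod_nonneg fun i _ => Real.rpow_nonneg (chainWeight_nonneg ..) _)

lemma aemeasurable_chainIncrement {T Ω : Type*} [MeasurableSpace Ω] {μ : Measure Ω}
    {Y : T → Ω → ℝ} (hY : ∀ t, AEMeasurable (Y t) μ) (π : ℕ → T → T) (i : ℕ) (t : T) :
    AEMeasurable (chainIncrement Y π i t) μ := by
  cases i with
  | zero => exact hY t
  | succ i => exact (hY t).sub (hY _)

lemma aemeasurable_chainWeight {T Ω : Type*} [MeasurableSpace Ω] {μ : Measure Ω}
    {Y : T → Ω → ℝ} (hY : ∀ t, AEMeasurable (Y t) μ) (π : ℕ → T → T) (A : ℕ → Finset T) (c : ℝ)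
    (i : ℕ) : AEMeasurable (chainWeight Y π A c i) μ := by
  unfold chainWeight
  refine Finset.aemeasurable_fun_sum _ fun s _ => ?_
  have := aemeasurable_chainIncrement hY π i s
  fun_prop

lemma lintegral_chainWeight_le {T Ω : Type*} [MeasurableSpace Ω] {μ : Measure Ω}
    {Y : T → Ω → ℝ} (hY : ∀ t, AEMeasurable (Y t) μ) (π : ℕ → T → T) (A : ℕ → Finset T) {c v : ℝ}
    {i : ℕ} (h : ∀ s ∈ A i, ∀ c : ℝ, ∫⁻ ω, ENNReal.ofReal (Real.exp (c * chainIncrement Y π i s ω)) ∂μ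
      ≤ ENNReal.ofReal (Real.exp (c ^ 2 * v ^ 2 / 2))) :
    ∫⁻ ω, ENNReal.ofReal (chainWeight Y π A c i ω) ∂μ ≤
      ENNReal.ofReal ((A i).card * (2 * Real.exp (c ^ 2 * v ^ 2 / 2))) := by
  have hm : ∀ s (c : ℝ), AEMeasurable
      (fun ω => ENNReal.ofReal (Real.exp (c * chainIncrement Y π i s ω))) μ := fun s c => by
    have := aemeasurable_chainIncrement hY π i s
    fun_prop
  have h1 : ∀ ω, ENNReal.ofReal (chainWeight Y π A c i ω) =
      ∑ s ∈ A i, (ENNReal.ofReal (Real.exp (c * chainIncrement Y π i s ω)) +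
        ENNReal.ofReal (Real.exp (-c * chainIncrement Y π i s ω))) := fun ω => by
    unfold chainWeight
    rw [ENNReal.ofReal_sum_of_nonneg fun _ _ => by positivity]
    exact Finset.sum_congr rfl fun s _ =>
      ENNReal.ofReal_add (Real.exp_pos _).le (Real.exp_pos _).le
  simp_rw [h1]
  rw [lintegral_finsetSum' (A i)
    (f := fun s ω => ENNReal.ofReal (Real.exp (c * chainIncrement Y π i s ω)) +
      ENNReal.ofReal (Real.exp (-c * chainIncrement Y π i s ω)))
    fun s _ => (hm s c).add (hm s (-c))]
  calc ∑ s ∈ A i, ∫⁻ ω, (ENNReal.ofReal (Real.exp (c * chainIncrement Y π i s ω)) +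
        ENNReal.ofReal (Real.exp (-c * chainIncrement Y π i s ω))) ∂μ
      ≤ ∑ s ∈ A i, ENNReal.ofReal (2 * Real.exp (c ^ 2 * v ^ 2 / 2)) := by
        refine Finset.sum_le_sum fun s hs => ?_
        rw [lintegral_add_left' (hm s c), two_mul,
          ENNReal.ofReal_add (Real.exp_pos _).le (Real.exp_pos _).le]
        refine add_le_add (h s hs c) ?_
        simpa using h s hs (-c)
    _ = _ := by
        rw [Finset.sum_const, nsmul_eq_mul, ENNReal.ofReal_mul (Nat.cast_nonneg _),
          ENNReal.ofReal_natCast]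

/-- Tail bound for the last level of a finite chain with sub-Gaussian increments. -/
theorem measure_exists_lt_abs_le_chain {T Ω : Type*} [MeasurableSpace Ω] {μ : Measure Ω}
    {Y : T → Ω → ℝ} (hY : ∀ t, AEMeasurable (Y t) μ) (π : ℕ → T → T) (A : ℕ → Finset T)
    (w : ℕ → ℝ) (K : ℕ) (hw : ∀ i ≤ K, 0 < w i) (hw1 : ∑ i ∈ Finset.range (K + 1), w i = 1)
    (hπ : ∀ i < K, ∀ t ∈ A (i + 1), π i t ∈ A i) {M : ℝ} (hM : 0 < M)
    (h : ∀ i ≤ K, ∀ s ∈ A i, ∀ c : ℝ,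
      ∫⁻ ω, ENNReal.ofReal (Real.exp (c * chainIncrement Y π i s ω)) ∂μ
        ≤ ENNReal.ofReal (Real.exp (c ^ 2 * (w i * M) ^ 2 / 2))) {u : ℝ} (hu : 0 < u) :
    μ {ω | ∃ t ∈ A K, u < |Y t ω|} ≤ ENNReal.ofReal (2 * Real.exp (-(u ^ 2 / (2 * M ^ 2))) *
      ∏ i ∈ Finset.range (K + 1), ((A i).card : ℝ) ^ w i) := by
  -- This `l` minimizes the Chernoff exponent `l² M² / 2 - l u`.
  set l : ℝ := u / M ^ 2 with hl_def
  have hl : 0 < l := by positivity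
  set E : ℝ := 2 * Real.exp (l ^ 2 * M ^ 2 / 2) with hE
  have hEpos : 0 < E := by positivity
  have hmem : ∀ i ∈ Finset.range (K + 1), i ≤ K := fun i hi =>
    Nat.lt_succ_iff.mp (Finset.mem_range.mp hi)
  set f : Ω → ENNReal := fun ω => ∏ i ∈ Finset.range (K + 1),
    ENNReal.ofReal (chainWeight Y π A (l / w i) i ω) ^ w i with hf
  have hfm : AEMeasurable f μ := by
    refine Finset.aemeasurable_fun_prod _ fun i _ => ?_
    have := aemeasurable_chainWeight hY π A (l / w i) i
    fun_prop
  have hsub : {ω | ∃ t ∈ A K, u < |Y t ω|} ⊆ {ω | ENNReal.ofReal (Real.exp (l * u)) ≤ f ω} := by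
    rintro ω ⟨t, ht, hut⟩
    have h1 := exp_abs_le_prod_chainWeight Y π A hl w ω K hw hπ t ht
    have h2 : f ω = ENNReal.ofReal (∏ i ∈ Finset.range (K + 1),
        chainWeight Y π A (l / w i) i ω ^ w i) := by
      rw [ENNReal.ofReal_prod_of_nonneg fun i _ => Real.rpow_nonneg (chainWeight_nonneg ..) _]
      exact Finset.prod_congr rfl fun i hi => ENNReal.ofReal_rpow_of_nonneg
        (chainWeight_nonneg ..) (hw i (hmem i hi)).le
    rw [Set.mem_ofPred_eq, h2]
    apply ENNReal.ofReal_le_ofReal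
    refine le_trans ?_ h1
    exact Real.exp_le_exp.mpr (mul_le_mul_of_nonneg_left hut.le hl.le)
  have hint : ∫⁻ ω, f ω ∂μ ≤ ENNReal.ofReal (E * ∏ i ∈ Finset.range (K + 1),
      ((A i).card : ℝ) ^ w i) := by
    -- Hölder with exponents `w i` of sum 1. Scale `w i * M` at argument `l / w i` makes the
    -- exponential moment the same on every level.
    calc ∫⁻ ω, f ω ∂μ ≤ ∏ i ∈ Finset.range (K + 1),
          (∫⁻ ω, ENNReal.ofReal (chainWeight Y π A (l / w i) i ω) ∂μ) ^ w i := by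
          refine ENNReal.lintegral_prod_norm_pow_le _ (fun i _ => ?_) hw1
            (fun i hi => (hw i (hmem i hi)).le)
          exact (aemeasurable_chainWeight hY π A (l / w i) i).ennreal_ofReal
      _ ≤ ∏ i ∈ Finset.range (K + 1), ENNReal.ofReal ((((A i).card : ℝ) * E) ^ w i) := by
          refine Finset.prod_le_prod' fun i hi => ?_
          have hwi := hw i (hmem i hi)
          rw [← ENNReal.ofReal_rpow_of_nonneg (by positivity) hwi.le]
          refine ENNReal.rpow_le_rpow ?_ hwi.le
          refine (lintegral_chainWeight_le hY π A (h i (hmem i hi))).trans_eq ?_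
          rw [hE, show (l / w i) ^ 2 * (w i * M) ^ 2 = l ^ 2 * M ^ 2 by field_simp]
      _ = _ := by
          rw [← ENNReal.ofReal_prod_of_nonneg fun i _ => by positivity]
          congr 1
          calc ∏ i ∈ Finset.range (K + 1), (((A i).card : ℝ) * E) ^ w i
              = ∏ i ∈ Finset.range (K + 1), (((A i).card : ℝ) ^ w i * E ^ w i) :=
                Finset.prod_congr rfl fun i _ => Real.mul_rpow (Nat.cast_nonneg _) hEpos.le
            _ = _ := by
                rw [Finset.prod_mul_distrib, ← Real.rpow_sum_of_pos hEpos, hw1, Real.rpow_one,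
                  mul_comm]
  have hmark := mul_meas_ge_le_lintegral₀ hfm (ENNReal.ofReal (Real.exp (l * u)))
  have hfin : ENNReal.ofReal (Real.exp (l * u)) * μ {ω | ∃ t ∈ A K, u < |Y t ω|} ≤
      ENNReal.ofReal (E * ∏ i ∈ Finset.range (K + 1), ((A i).card : ℝ) ^ w i) :=
    (mul_le_mul_right (measure_mono hsub) _).trans (hmark.trans hint)
  have hexp : ENNReal.ofReal (Real.exp (-(l * u))) * ENNReal.ofReal (Real.exp (l * u)) = 1 := by
    rw [← ENNReal.ofReal_mul (Real.exp_pos _).le, ← Real.exp_add]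
    simp
  calc μ {ω | ∃ t ∈ A K, u < |Y t ω|}
      = ENNReal.ofReal (Real.exp (-(l * u))) * (ENNReal.ofReal (Real.exp (l * u)) *
          μ {ω | ∃ t ∈ A K, u < |Y t ω|}) := by rw [← mul_assoc, hexp, one_mul]
    _ ≤ ENNReal.ofReal (Real.exp (-(l * u))) *
          ENNReal.ofReal (E * ∏ i ∈ Finset.range (K + 1), ((A i).card : ℝ) ^ w i) :=
        mul_le_mul_right hfin _
    _ = _ := by
        rw [← ENNReal.ofReal_mul (Real.exp_pos _).le, ← mul_assoc, hE,
          mul_left_comm (Real.exp (-(l * u))), ← Real.exp_add]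
        congr 4
        rw [hl_def]
        field_simp
        ring

/-! ### Geometric weights and the entropy bound -/

lemma sum_geometric_weights (p : ℝ) (K : ℕ) :
    ∑ i ∈ Finset.range K, (1 - p) * p ^ i = 1 - p ^ K := by
  induction K with
  | zero => simp
  | succ K ih => rw [Finset.sum_range_succ, ih]; ring

lemma sum_succ_mul_geometric_weights_le {p : ℝ} (hp0 : 0 < p) (hp1 : p < 1) (K : ℕ) :
    ∑ i ∈ Finset.range K, (1 - p) * p ^ i * ((i : ℝ) + 1) ≤ 1 / (1 - p) := by
  have h1 : 0 < 1 - p := by linarith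
  have h : ∑ i ∈ Finset.range K, (1 - p) * p ^ i * ((i : ℝ) + 1) =
      (1 - p ^ K) / (1 - p) - K * p ^ K := by
    induction K with
    | zero => simp
    | succ K ih =>
      rw [Finset.sum_range_succ, ih]
      push_cast
      field_simp
      ring
  rw [h]
  have h2 : 0 ≤ (K : ℝ) * p ^ K := by positivity
  have h3 : (1 - p ^ K) / (1 - p) ≤ 1 / (1 - p) :=
    div_le_div_of_nonneg_right (by linarith [pow_pos hp0 K]) h1.le
  linarith

/-- Entropy bound for a sub-Gaussian family of unit scale whose covering numbers grow at most
like `N v ^ (-Q)`. -/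
theorem measure_exists_lt_abs_le_of_covering {T Ω : Type*} [MeasurableSpace Ω] {μ : Measure Ω}
    {Y : T → Ω → ℝ} (hY : ∀ t, AEMeasurable (Y t) μ)
    (h1 : ∀ t, ∀ c : ℝ, ∫⁻ ω, ENNReal.ofReal (Real.exp (c * Y t ω)) ∂μ
        ≤ ENNReal.ofReal (Real.exp (c ^ 2 / 2))) {N Q : ℝ} (hN : 1 ≤ N) (hQ : 0 ≤ Q)
    (hnet : ∀ v : ℝ, 0 < v → v ≤ 1 → ∃ A : Finset T, (A.card : ℝ) ≤ N * v ^ (-Q) ∧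
      ∀ t, ∃ s ∈ A, ∀ c : ℝ, ∫⁻ ω, ENNReal.ofReal (Real.exp (c * (Y t ω - Y s ω))) ∂μ
        ≤ ENNReal.ofReal (Real.exp (c ^ 2 * v ^ 2 / 2)))
    {p : ℝ} (hp0 : 0 < p) (hp1 : p < 1) {u : ℝ} (hu : 0 < u) (F : Finset T) :
    μ {ω | ∃ t ∈ F, u < |Y t ω|} ≤ ENNReal.ofReal (2 * Real.exp (-(u ^ 2 * (1 - p) ^ 2 / 2)) *
      (N * (Real.exp 1 / p) ^ Q)) := by
  rcases F.eq_empty_or_nonempty with rfl | hF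
  · simp
  have hq : 0 < 1 - p := by linarith
  have hcard : (1 : ℝ) ≤ F.card := by exact_mod_cast hF.card_pos
  choose A hAcard hAnet using fun k : ℕ => hnet (p ^ (k + 1)) (pow_pos hp0 _)
    (pow_le_one₀ hp0.le hp1.le)
  choose π hπA hπ using hAnet
  have key : ∀ K : ℕ, μ {ω | ∃ t ∈ F, u < |Y t ω|} ≤
      ENNReal.ofReal (2 * Real.exp (-(u ^ 2 * (1 - p) ^ 2 / 2)) *
      (N * (Real.exp 1 / p) ^ Q * (F.card : ℝ) ^ (p ^ K))) := by
    intro K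
    -- Levels below `K` are the nets, and level `K` is `F` itself carrying the leftover weight `p ^
    -- K`. Net `A i` has mesh `p ^ (i + 1)`, so the increment at level `i + 1` has scale `p ^ (i +
    -- 1)`; level 0 has scale `p ^ 0 = 1` by unit variance. Thus `M = 1 / (1 - p)` serves every
    -- level.
    set B : ℕ → Finset T := fun i => if i < K then A i else F with hB
    set w : ℕ → ℝ := fun i => if i < K then (1 - p) * p ^ i else p ^ K with hw
    have hwpos : ∀ i, 0 < w i := fun i => by
      simp only [hw]; split_ifs <;> positivity
    have hwsum : ∑ i ∈ Finset.range (K + 1), w i = 1 := by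
      rw [Finset.sum_range_succ]
      have : ∑ i ∈ Finset.range K, w i = ∑ i ∈ Finset.range K, (1 - p) * p ^ i :=
        Finset.sum_congr rfl fun i hi => by simp [hw, Finset.mem_range.mp hi]
      rw [this, sum_geometric_weights]
      simp [hw]
    have hscale : ∀ i ≤ K, p ^ i ≤ w i * (1 / (1 - p)) := fun i hi => by
      rcases hi.lt_or_eq with hi | rfl
      · simp only [hw, hi, if_true]
        rw [mul_one_div, le_div_iff₀ hq, mul_comm]
      · simp only [hw, lt_irrefl, if_false]
        rw [mul_one_div, le_div_iff₀ hq]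
        nlinarith [pow_pos hp0 i]
    have hπB : ∀ i < K, ∀ t ∈ B (i + 1), π i t ∈ B i := fun i hi t _ => by
      simp only [hB, hi, if_true]
      exact hπA i t
    have hbound : ∀ i ≤ K, ∀ s ∈ B i, ∀ c : ℝ,
        ∫⁻ ω, ENNReal.ofReal (Real.exp (c * chainIncrement Y π i s ω)) ∂μ
        ≤ ENNReal.ofReal (Real.exp (c ^ 2 * (w i * (1 / (1 - p))) ^ 2 / 2)) := by
      intro i hi s _ c
      have hmono : ENNReal.ofReal (Real.exp (c ^ 2 * (p ^ i) ^ 2 / 2)) ≤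
          ENNReal.ofReal (Real.exp (c ^ 2 * (w i * (1 / (1 - p))) ^ 2 / 2)) := by
        apply ENNReal.ofReal_le_ofReal
        apply Real.exp_le_exp.mpr
        have := pow_le_pow_left₀ (pow_pos hp0 i).le (hscale i hi) 2
        have := mul_le_mul_of_nonneg_left this (sq_nonneg c)
        linarith
      refine le_trans ?_ hmono
      cases i with
      | zero => simpa [chainIncrement] using h1 s c
      | succ i => exact hπ i s c
    have hmain := measure_exists_lt_abs_le_chain hY π B w K (fun i _ => hwpos i) hwsum hπB
      (one_div_pos.mpr hq) hbound hu
    have hBK : B K = F := by simp [hB]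
    rw [hBK] at hmain
    refine hmain.trans (ENNReal.ofReal_le_ofReal ?_)
    have e1 : u ^ 2 / (2 * (1 / (1 - p)) ^ 2) = u ^ 2 * (1 - p) ^ 2 / 2 := by field_simp
    rw [e1]
    apply mul_le_mul_of_nonneg_left _ (by positivity)
    rw [Finset.prod_range_succ, hBK]
    have hwK : w K = p ^ K := by simp [hw]
    rw [hwK]
    apply mul_le_mul_of_nonneg_right _ (by positivity)
    have hNpos : 0 < N := by linarith
    have hlogN : 0 ≤ Real.log N := Real.log_nonneg hN
    have hL0 : 0 ≤ -Real.log p := by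
      have := Real.log_nonpos hp0.le hp1.le
      linarith
    have hcardexp : ∀ i, ((A i).card : ℝ) ≤
        Real.exp (Real.log N + (i + 1 : ℝ) * (Q * -Real.log p)) := fun i => by
      refine (hAcard i).trans_eq ?_
      rw [Real.exp_add, Real.exp_log hNpos, Real.rpow_def_of_pos (pow_pos hp0 _), Real.log_pow]
      congr 2
      push_cast
      ring
    calc ∏ i ∈ Finset.range K, ((B i).card : ℝ) ^ w i
        ≤ ∏ i ∈ Finset.range K,
            Real.exp ((1 - p) * p ^ i * (Real.log N + (i + 1 : ℝ) * (Q * -Real.log p))) := by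
          refine Finset.prod_le_prod (fun i _ => by positivity) fun i hi => ?_
          have hi' := Finset.mem_range.mp hi
          simp only [hB, hw, hi', if_true]
          rw [mul_comm ((1 - p) * p ^ i), Real.exp_mul]
          exact Real.rpow_le_rpow (Nat.cast_nonneg _) (hcardexp i) (by positivity)
      _ = Real.exp ((1 - p ^ K) * Real.log N +
            (∑ i ∈ Finset.range K, (1 - p) * p ^ i * ((i : ℝ) + 1)) * (Q * -Real.log p)) := by
          rw [← Real.exp_sum, ← sum_geometric_weights p K, Finset.sum_mul, Finset.sum_mul,
            ← Finset.sum_add_distrib]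
          congr 1
          exact Finset.sum_congr rfl fun i _ => by ring
      _ ≤ Real.exp (Real.log N + (1 + -Real.log p) * Q) := by
          apply Real.exp_le_exp.mpr
          apply add_le_add
          · nlinarith [pow_pos hp0 K]
          · have h2 := sum_succ_mul_geometric_weights_le hp0 hp1 K
            -- Equivalent to `-p log p ≤ 1 - p`, which is `log x ≤ x - 1` at `x = 1 / p`. It turns
            -- the entropy sum into the closed form `(e / p) ^ Q`.
            have h3 : 1 / (1 - p) * -Real.log p ≤ 1 + -Real.log p := by
              have h4 := Real.log_le_sub_one_of_pos (inv_pos.mpr hp0)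
              rw [Real.log_inv] at h4
              have h5 : p * -Real.log p ≤ 1 - p := by
                have := mul_le_mul_of_nonneg_left h4 hp0.le
                rwa [mul_sub, mul_inv_cancel₀ hp0.ne', mul_one] at this
              rw [one_div_mul_eq_div, div_le_iff₀ hq]
              nlinarith
            calc _ ≤ 1 / (1 - p) * (Q * -Real.log p) :=
                  mul_le_mul_of_nonneg_right h2 (by positivity)
              _ = (1 / (1 - p) * -Real.log p) * Q := by ring
              _ ≤ _ := mul_le_mul_of_nonneg_right h3 hQ
      _ = N * (Real.exp 1 / p) ^ Q := by
          rw [Real.exp_add, Real.exp_log hNpos, Real.exp_mul, Real.exp_add, Real.exp_neg,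
            Real.exp_log hp0, div_eq_mul_inv]
  -- As `K` grows the weight of `F` tends to 0, so its cardinality drops out of the bound.
  have hlim : Filter.Tendsto (fun K : ℕ =>
      ENNReal.ofReal (2 * Real.exp (-(u ^ 2 * (1 - p) ^ 2 / 2)) *
      (N * (Real.exp 1 / p) ^ Q * (F.card : ℝ) ^ (p ^ K)))) Filter.atTop
      (nhds (ENNReal.ofReal (2 * Real.exp (-(u ^ 2 * (1 - p) ^ 2 / 2)) *
      (N * (Real.exp 1 / p) ^ Q * (F.card : ℝ) ^ (0 : ℝ))))) := by
    refine (ENNReal.continuous_ofReal.tendsto _).comp ?_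
    refine Filter.Tendsto.const_mul _ (Filter.Tendsto.const_mul _ ?_)
    exact (Real.continuousAt_const_rpow (by linarith)).tendsto.comp
      (tendsto_pow_atTop_nhds_zero_of_lt_one hp0.le hp1)
  simpa using ge_of_tendsto' hlim key

/-! ### Second moments of the field and of its increments -/

lemma SameFDD.integral_sq_eq {ι Ω : Type*} [MeasurableSpace Ω] {μ : Measure Ω} {X Y : ι → Ω → ℝ}
    (h : SameFDD μ X Y) (hX : ∀ i, AEMeasurable (X i) μ) (hY : ∀ i, AEMeasurable (Y i) μ) (i : ι) :
    ∫ ω, X i ω ^ 2 ∂μ = ∫ ω, Y i ω ^ 2 ∂μ := by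
  have hi := h {i}
  set j : ({i} : Finset ι) := ⟨i, Finset.mem_singleton_self i⟩
  have hg : Measurable fun f : ({i} : Finset ι) → ℝ => f j ^ 2 := by fun_prop
  have hXm : AEMeasurable (fun ω (k : ({i} : Finset ι)) => X k ω) μ :=
    aemeasurable_pi_lambda _ fun k => hX k
  have hYm : AEMeasurable (fun ω (k : ({i} : Finset ι)) => Y k ω) μ :=
    aemeasurable_pi_lambda _ fun k => hY k
  have h1 := integral_map hXm hg.aestronglyMeasurable
  have h2 := integral_map hYm hg.aestronglyMeasurable
  rw [hi] at h1
  exact h1.symm.trans h2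

/-- The standard deviation `t₁ ^ H₁ t₂ ^ H₂` of the field at `t`. -/
noncomputable def fieldScale (H₁ H₂ : ℝ) (t : ℝ≥0 × ℝ≥0) : ℝ := (t.1 : ℝ) ^ H₁ * (t.2 : ℝ) ^ H₂

lemma fieldScale_pos (H₁ H₂ : ℝ) {t : ℝ≥0 × ℝ≥0} (h1 : 0 < t.1) (h2 : 0 < t.2) :
    0 < fieldScale H₁ H₂ t := by
  unfold fieldScale
  have : (0 : ℝ) < t.1 := h1
  have : (0 : ℝ) < t.2 := h2
  positivity

/-- The field divided by its standard deviation. -/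
noncomputable def normalizedField {Ω : Type*} (X : ℝ≥0 × ℝ≥0 → Ω → ℝ) (H₁ H₂ : ℝ)
    (t : ℝ≥0 × ℝ≥0) (ω : Ω) : ℝ := (fieldScale H₁ H₂ t)⁻¹ * X t ω

section Moments

variable {Ω : Type*} [MeasurableSpace Ω] {μ : Measure Ω} {X : ℝ≥0 × ℝ≥0 → Ω → ℝ} {H₁ H₂ : ℝ}

lemma integral_sq_of_isSelfSimilar (hX : ∀ t, AEMeasurable (X t) μ)
    (hself : IsSelfSimilar μ X H₁ H₂) {a₁ a₂ : ℝ≥0} (h1 : 0 < a₁) (h2 : 0 < a₂) (t : ℝ≥0 × ℝ≥0) :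
    ∫ ω, X (a₁ * t.1, a₂ * t.2) ω ^ 2 ∂μ = fieldScale H₁ H₂ (a₁, a₂) ^ 2 * ∫ ω, X t ω ^ 2 ∂μ := by
  have h := (hself a₁ a₂ h1 h2).integral_sq_eq (fun t => hX _) (fun t => (hX t).const_mul _) t
  rw [h, ← integral_const_mul]
  simp only [mul_pow, fieldScale]

lemma integral_sq_eq_fieldScale_sq (hX : ∀ t, AEMeasurable (X t) μ)
    (hself : IsSelfSimilar μ X H₁ H₂) (hnorm : ∫ ω, X (1, 1) ω ^ 2 ∂μ = 1) {t : ℝ≥0 × ℝ≥0}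
    (h1 : 0 < t.1) (h2 : 0 < t.2) : ∫ ω, X t ω ^ 2 ∂μ = fieldScale H₁ H₂ t ^ 2 := by
  have h := integral_sq_of_isSelfSimilar hX hself h1 h2 (1, 1)
  simpa [hnorm] using h

lemma ae_eq_zero_of_integral_sq_eq_mul {Z : Ω → ℝ} (hZ : MemLp Z 2 μ) {c : ℝ} (hc : c ≠ 1)
    (h : ∫ ω, Z ω ^ 2 ∂μ = c * ∫ ω, Z ω ^ 2 ∂μ) : Z =ᵐ[μ] 0 := by
  have h0 : ∫ ω, Z ω ^ 2 ∂μ = 0 := by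
    have : (1 - c) * ∫ ω, Z ω ^ 2 ∂μ = 0 := by linarith
    exact (mul_eq_zero.mp this).resolve_left (sub_ne_zero.mpr hc.symm)
  have h1 := (integral_eq_zero_iff_of_nonneg (fun ω => sq_nonneg (Z ω)) hZ.integrable_sq).mp h0
  filter_upwards [h1] with ω hω
  simpa using hω

lemma two_rpow_sq_ne_one {H : ℝ} (hH : 0 < H) : ((2 : ℝ) ^ H) ^ 2 ≠ 1 := by
  have : 1 < (2 : ℝ) ^ H := Real.one_lt_rpow (by norm_num) hH
  nlinarith

/-- Doubling the first coordinate fixes the point `(0, s)` but multiplies its second moment by `4 ^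
H₁ ≠ 1`. -/
lemma ae_eq_zero_of_fst_eq_zero (hX : ∀ t, MemLp (X t) 2 μ) (hself : IsSelfSimilar μ X H₁ H₂)
    (hH₁ : 0 < H₁) (s : ℝ≥0) : X (0, s) =ᵐ[μ] 0 := by
  have h := integral_sq_of_isSelfSimilar (fun t => (hX t).aestronglyMeasurable.aemeasurable) hself
    (a₁ := 2) (a₂ := 1) (by norm_num) one_pos (0, s)
  exact ae_eq_zero_of_integral_sq_eq_mul (hX _) (two_rpow_sq_ne_one hH₁)
    (by simpa [fieldScale] using h)

lemma ae_eq_zero_of_snd_eq_zero (hX : ∀ t, MemLp (X t) 2 μ) (hself : IsSelfSimilar μ X H₁ H₂)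
    (hH₂ : 0 < H₂) (s : ℝ≥0) : X (s, 0) =ᵐ[μ] 0 := by
  have h := integral_sq_of_isSelfSimilar (fun t => (hX t).aestronglyMeasurable.aemeasurable) hself
    (a₁ := 1) (a₂ := 2) one_pos (by norm_num) (s, 0)
  exact ae_eq_zero_of_integral_sq_eq_mul (hX _) (two_rpow_sq_ne_one hH₂)
    (by simpa [fieldScale] using h)

/-- Stationarity moves the increment to the origin, where three of the four corner values vanish
almost surely and only `X h` remains. -/
lemma integral_rectIncrement_sq (hX : ∀ t, MemLp (X t) 2 μ) (hself : IsSelfSimilar μ X H₁ H₂)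
    (hstat : HasStationaryRectIncrements μ X) (hnorm : ∫ ω, X (1, 1) ω ^ 2 ∂μ = 1)
    (hH₁ : 0 < H₁) (hH₂ : 0 < H₂) (u : ℝ≥0 × ℝ≥0) {h : ℝ≥0 × ℝ≥0} (h1 : 0 < h.1) (h2 : 0 < h.2) :
    ∫ ω, rectIncrement X u (u + h) ω ^ 2 ∂μ = fieldScale H₁ H₂ h ^ 2 := by
  have hXm : ∀ t, AEMeasurable (X t) μ := fun t => (hX t).aestronglyMeasurable.aemeasurable
  have hrm : ∀ u v, AEMeasurable (rectIncrement X u v) μ := fun u v =>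
    (((hXm _).sub (hXm _)).sub (hXm _)).add (hXm _)
  rw [(hstat u).integral_sq_eq (fun _ => hrm _ _) (fun _ => hrm _ _) h,
    ← integral_sq_eq_fieldScale_sq hXm hself hnorm h1 h2]
  apply integral_congr_ae
  filter_upwards [ae_eq_zero_of_fst_eq_zero hX hself hH₁ h.2,
    ae_eq_zero_of_fst_eq_zero hX hself hH₁ 0, ae_eq_zero_of_snd_eq_zero hX hself hH₂ h.1]
    with ω e1 e2 e3
  have e1' : X ((0 : ℝ≥0 × ℝ≥0).1, h.2) ω = 0 := e1
  have e2' : X ((0 : ℝ≥0 × ℝ≥0).1, (0 : ℝ≥0 × ℝ≥0).2) ω = 0 := e2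
  have e3' : X (h.1, (0 : ℝ≥0 × ℝ≥0).2) ω = 0 := e3
  simp only [rectIncrement, e1', e2', e3']
  simp

/-- Anchoring the rectangle at `(a, 0)` on the axis makes its two lower corner values vanish. -/
lemma integral_sub_sq_fst (hX : ∀ t, MemLp (X t) 2 μ) (hself : IsSelfSimilar μ X H₁ H₂)
    (hstat : HasStationaryRectIncrements μ X) (hnorm : ∫ ω, X (1, 1) ω ^ 2 ∂μ = 1)
    (hH₁ : 0 < H₁) (hH₂ : 0 < H₂) {a b t : ℝ≥0} (hab : a < b) (ht : 0 < t) :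
    ∫ ω, (X (b, t) ω - X (a, t) ω) ^ 2 ∂μ = fieldScale H₁ H₂ (b - a, t) ^ 2 := by
  rw [← integral_rectIncrement_sq hX hself hstat hnorm hH₁ hH₂ (a, 0) (h := (b - a, t))
    (tsub_pos_of_lt hab) ht]
  apply integral_congr_ae
  filter_upwards [ae_eq_zero_of_snd_eq_zero hX hself hH₂ a,
    ae_eq_zero_of_snd_eq_zero hX hself hH₂ b] with ω e1 e2
  have e1' : X (a, 0) ω = 0 := e1
  have e2' : X (b, 0) ω = 0 := e2
  simp [rectIncrement, add_tsub_cancel_of_le hab.le, e1', e2']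

lemma integral_sub_sq_snd (hX : ∀ t, MemLp (X t) 2 μ) (hself : IsSelfSimilar μ X H₁ H₂)
    (hstat : HasStationaryRectIncrements μ X) (hnorm : ∫ ω, X (1, 1) ω ^ 2 ∂μ = 1)
    (hH₁ : 0 < H₁) (hH₂ : 0 < H₂) {a b t : ℝ≥0} (hab : a < b) (ht : 0 < t) :
    ∫ ω, (X (t, b) ω - X (t, a) ω) ^ 2 ∂μ = fieldScale H₁ H₂ (t, b - a) ^ 2 := by
  rw [← integral_rectIncrement_sq hX hself hstat hnorm hH₁ hH₂ (0, a) (h := (t, b - a))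
    ht (tsub_pos_of_lt hab)]
  apply integral_congr_ae
  filter_upwards [ae_eq_zero_of_fst_eq_zero hX hself hH₁ a,
    ae_eq_zero_of_fst_eq_zero hX hself hH₁ b] with ω e1 e2
  have e1' : X (0, a) ω = 0 := e1
  have e2' : X (0, b) ω = 0 := e2
  simp [rectIncrement, add_tsub_cancel_of_le hab.le, e1', e2']

/-- Normalizing two variables contracts their distance, up to the product of the norms. -/
lemma integral_sub_sq_normalized_le {A B : Ω → ℝ} (hA : MemLp A 2 μ) (hB : MemLp B 2 μ) {α β D : ℝ}
    (hα : 0 < α) (hβ : 0 < β) (hA2 : ∫ ω, A ω ^ 2 ∂μ = α ^ 2) (hB2 : ∫ ω, B ω ^ 2 ∂μ = β ^ 2)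
    (hD : ∫ ω, (A ω - B ω) ^ 2 ∂μ = D ^ 2) :
    ∫ ω, (α⁻¹ * A ω - β⁻¹ * B ω) ^ 2 ∂μ ≤ D ^ 2 / (α * β) := by
  have e : ∀ ω, (α⁻¹ * A ω - β⁻¹ * B ω) ^ 2 =
      (α⁻¹ ^ 2 - α⁻¹ * β⁻¹) * A ω ^ 2 + (β⁻¹ ^ 2 - α⁻¹ * β⁻¹) * B ω ^ 2 +
        α⁻¹ * β⁻¹ * (A ω - B ω) ^ 2 := fun ω => by ring
  have iA := hA.integrable_sq
  have iB := hB.integrable_sq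
  have iD : Integrable (fun ω => (A ω - B ω) ^ 2) μ := (hA.sub hB).integrable_sq
  have iAB : Integrable (fun ω => (α⁻¹ ^ 2 - α⁻¹ * β⁻¹) * A ω ^ 2 +
      (β⁻¹ ^ 2 - α⁻¹ * β⁻¹) * B ω ^ 2) μ := (iA.const_mul _).add (iB.const_mul _)
  simp_rw [e]
  rw [integral_add iAB (iD.const_mul _),
    integral_add (iA.const_mul _) (iB.const_mul _), integral_const_mul, integral_const_mul,
    integral_const_mul, hA2, hB2, hD]
  -- The discarded term `(α - β)² / (α β)` is nonnegative.
  have : (α⁻¹ ^ 2 - α⁻¹ * β⁻¹) * α ^ 2 + (β⁻¹ ^ 2 - α⁻¹ * β⁻¹) * β ^ 2 + α⁻¹ * β⁻¹ * D ^ 2 =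
      D ^ 2 / (α * β) - (α - β) ^ 2 / (α * β) := by
    field_simp
    ring
  rw [this]
  have : 0 ≤ (α - β) ^ 2 / (α * β) := by positivity
  linarith

/-- The powers of `t` cancel, and both endpoints are at least `c`. The bound therefore depends only
on the distance relative to `c`, which makes it uniform over dyadic blocks. -/
lemma integral_normalizedField_sub_sq_fst_le (hX : ∀ t, MemLp (X t) 2 μ)
    (hself : IsSelfSimilar μ X H₁ H₂) (hstat : HasStationaryRectIncrements μ X)
    (hnorm : ∫ ω, X (1, 1) ω ^ 2 ∂μ = 1) (hH₁ : 0 < H₁) (hH₂ : 0 < H₂) {c a b t : ℝ≥0} {r : ℝ}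
    (hc : 0 < c) (hr : 0 < r) (ha : c ≤ a) (hb : c ≤ b) (hab : |(b : ℝ) - a| ≤ c * r) (ht : 0 < t) :
    ∫ ω, (normalizedField X H₁ H₂ (b, t) ω - normalizedField X H₁ H₂ (a, t) ω) ^ 2 ∂μ
      ≤ (r ^ H₁) ^ 2 := by
  have hXm : ∀ t, AEMeasurable (X t) μ := fun t => (hX t).aestronglyMeasurable.aemeasurable
  have main : ∀ a b : ℝ≥0, c ≤ a → a < b → (b : ℝ) - a ≤ c * r →
      ∫ ω, (normalizedField X H₁ H₂ (b, t) ω - normalizedField X H₁ H₂ (a, t) ω) ^ 2 ∂μ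
      ≤ (r ^ H₁) ^ 2 := by
    intro a b ha hab hle
    have ha0 : 0 < a := hc.trans_le ha
    have hb0 : 0 < b := ha0.trans hab
    refine (integral_sub_sq_normalized_le (hX (b, t)) (hX (a, t))
      (fieldScale_pos H₁ H₂ (t := (b, t)) hb0 ht) (fieldScale_pos H₁ H₂ (t := (a, t)) ha0 ht)
      (integral_sq_eq_fieldScale_sq hXm hself hnorm hb0 ht)
      (integral_sq_eq_fieldScale_sq hXm hself hnorm ha0 ht)
      (integral_sub_sq_fst hX hself hstat hnorm hH₁ hH₂ hab ht)).trans ?_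
    have htH : 0 < (t : ℝ) ^ H₂ := Real.rpow_pos_of_pos (by exact_mod_cast ht) _
    have hcR : (0 : ℝ) < c := by exact_mod_cast hc
    have hcH : 0 < (c : ℝ) ^ H₁ := Real.rpow_pos_of_pos hcR _
    have haH : (c : ℝ) ^ H₁ ≤ (a : ℝ) ^ H₁ :=
      Real.rpow_le_rpow hcR.le (by exact_mod_cast ha) hH₁.le
    have hbH : (c : ℝ) ^ H₁ ≤ (b : ℝ) ^ H₁ :=
      Real.rpow_le_rpow hcR.le (by exact_mod_cast ha.trans hab.le) hH₁.le
    have hdH : ((b - a : ℝ≥0) : ℝ) ^ H₁ ≤ (c : ℝ) ^ H₁ * r ^ H₁ := by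
      rw [← Real.mul_rpow hcR.le hr.le]
      refine Real.rpow_le_rpow (NNReal.coe_nonneg _) ?_ hH₁.le
      rwa [NNReal.coe_sub hab.le]
    have hd0 : 0 ≤ ((b - a : ℝ≥0) : ℝ) ^ H₁ := Real.rpow_nonneg (NNReal.coe_nonneg _) _
    simp only [fieldScale]
    rw [div_le_iff₀ (by positivity)]
    have h1 := pow_le_pow_left₀ hd0 hdH 2
    have h2 : (c : ℝ) ^ H₁ * (c : ℝ) ^ H₁ ≤ (b : ℝ) ^ H₁ * (a : ℝ) ^ H₁ :=
      mul_le_mul hbH haH hcH.le (hcH.le.trans hbH)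
    calc (((b - a : ℝ≥0) : ℝ) ^ H₁ * (t : ℝ) ^ H₂) ^ 2
        = (((b - a : ℝ≥0) : ℝ) ^ H₁) ^ 2 * ((t : ℝ) ^ H₂) ^ 2 := by ring
      _ ≤ ((c : ℝ) ^ H₁ * r ^ H₁) ^ 2 * ((t : ℝ) ^ H₂) ^ 2 :=
          mul_le_mul_of_nonneg_right h1 (by positivity)
      _ = (r ^ H₁) ^ 2 * ((t : ℝ) ^ H₂) ^ 2 * ((c : ℝ) ^ H₁ * (c : ℝ) ^ H₁) := by ring
      _ ≤ (r ^ H₁) ^ 2 * ((t : ℝ) ^ H₂) ^ 2 * ((b : ℝ) ^ H₁ * (a : ℝ) ^ H₁) :=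
          mul_le_mul_of_nonneg_left h2 (by positivity)
      _ = _ := by ring
  rcases lt_trichotomy a b with h | h | h
  · exact main a b ha h ((le_abs_self _).trans hab)
  · subst h
    simp only [sub_self]
    simpa using sq_nonneg _
  · have := main b a hb h (by rw [abs_sub_comm] at hab; exact (le_abs_self _).trans hab)
    simpa only [sub_sq_comm] using this

lemma integral_normalizedField_sub_sq_snd_le (hX : ∀ t, MemLp (X t) 2 μ)
    (hself : IsSelfSimilar μ X H₁ H₂) (hstat : HasStationaryRectIncrements μ X)
    (hnorm : ∫ ω, X (1, 1) ω ^ 2 ∂μ = 1) (hH₁ : 0 < H₁) (hH₂ : 0 < H₂) {c a b t : ℝ≥0} {r : ℝ}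
    (hc : 0 < c) (hr : 0 < r) (ha : c ≤ a) (hb : c ≤ b) (hab : |(b : ℝ) - a| ≤ c * r) (ht : 0 < t) :
    ∫ ω, (normalizedField X H₁ H₂ (t, b) ω - normalizedField X H₁ H₂ (t, a) ω) ^ 2 ∂μ
      ≤ (r ^ H₂) ^ 2 := by
  have hXm : ∀ t, AEMeasurable (X t) μ := fun t => (hX t).aestronglyMeasurable.aemeasurable
  have main : ∀ a b : ℝ≥0, c ≤ a → a < b → (b : ℝ) - a ≤ c * r →
      ∫ ω, (normalizedField X H₁ H₂ (t, b) ω - normalizedField X H₁ H₂ (t, a) ω) ^ 2 ∂μ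
      ≤ (r ^ H₂) ^ 2 := by
    intro a b ha hab hle
    have ha0 : 0 < a := hc.trans_le ha
    have hb0 : 0 < b := ha0.trans hab
    refine (integral_sub_sq_normalized_le (hX (t, b)) (hX (t, a))
      (fieldScale_pos H₁ H₂ (t := (t, b)) ht hb0) (fieldScale_pos H₁ H₂ (t := (t, a)) ht ha0)
      (integral_sq_eq_fieldScale_sq hXm hself hnorm ht hb0)
      (integral_sq_eq_fieldScale_sq hXm hself hnorm ht ha0)
      (integral_sub_sq_snd hX hself hstat hnorm hH₁ hH₂ hab ht)).trans ?_
    have htH : 0 < (t : ℝ) ^ H₁ := Real.rpow_pos_of_pos (by exact_mod_cast ht) _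
    have hcR : (0 : ℝ) < c := by exact_mod_cast hc
    have hcH : 0 < (c : ℝ) ^ H₂ := Real.rpow_pos_of_pos hcR _
    have haH : (c : ℝ) ^ H₂ ≤ (a : ℝ) ^ H₂ :=
      Real.rpow_le_rpow hcR.le (by exact_mod_cast ha) hH₂.le
    have hbH : (c : ℝ) ^ H₂ ≤ (b : ℝ) ^ H₂ :=
      Real.rpow_le_rpow hcR.le (by exact_mod_cast ha.trans hab.le) hH₂.le
    have hdH : ((b - a : ℝ≥0) : ℝ) ^ H₂ ≤ (c : ℝ) ^ H₂ * r ^ H₂ := by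
      rw [← Real.mul_rpow hcR.le hr.le]
      refine Real.rpow_le_rpow (NNReal.coe_nonneg _) ?_ hH₂.le
      rwa [NNReal.coe_sub hab.le]
    have hd0 : 0 ≤ ((b - a : ℝ≥0) : ℝ) ^ H₂ := Real.rpow_nonneg (NNReal.coe_nonneg _) _
    simp only [fieldScale]
    rw [div_le_iff₀ (by positivity)]
    have h1 := pow_le_pow_left₀ hd0 hdH 2
    have h2 : (c : ℝ) ^ H₂ * (c : ℝ) ^ H₂ ≤ (b : ℝ) ^ H₂ * (a : ℝ) ^ H₂ :=
      mul_le_mul hbH haH hcH.le (hcH.le.trans hbH)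
    calc ((t : ℝ) ^ H₁ * ((b - a : ℝ≥0) : ℝ) ^ H₂) ^ 2
        = (((b - a : ℝ≥0) : ℝ) ^ H₂) ^ 2 * ((t : ℝ) ^ H₁) ^ 2 := by ring
      _ ≤ ((c : ℝ) ^ H₂ * r ^ H₂) ^ 2 * ((t : ℝ) ^ H₁) ^ 2 :=
          mul_le_mul_of_nonneg_right h1 (by positivity)
      _ = (r ^ H₂) ^ 2 * ((t : ℝ) ^ H₁) ^ 2 * ((c : ℝ) ^ H₂ * (c : ℝ) ^ H₂) := by ring
      _ ≤ (r ^ H₂) ^ 2 * ((t : ℝ) ^ H₁) ^ 2 * ((b : ℝ) ^ H₂ * (a : ℝ) ^ H₂) :=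
          mul_le_mul_of_nonneg_left h2 (by positivity)
      _ = _ := by ring
  rcases lt_trichotomy a b with h | h | h
  · exact main a b ha h ((le_abs_self _).trans hab)
  · subst h
    simp only [sub_self]
    simpa using sq_nonneg _
  · have := main b a hb h (by rw [abs_sub_comm] at hab; exact (le_abs_self _).trans hab)
    simpa only [sub_sq_comm] using this

/-- Minkowski's inequality in `L²`; the pointwise slack is the square `(b A - a B)² / (a b)`. -/
lemma integral_add_sq_le {A B : Ω → ℝ} (hA : MemLp A 2 μ) (hB : MemLp B 2 μ) {a b : ℝ}
    (ha : 0 < a) (hb : 0 < b) (hA2 : ∫ ω, A ω ^ 2 ∂μ ≤ a ^ 2) (hB2 : ∫ ω, B ω ^ 2 ∂μ ≤ b ^ 2) :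
    ∫ ω, (A ω + B ω) ^ 2 ∂μ ≤ (a + b) ^ 2 := by
  have iA := hA.integrable_sq
  have iB := hB.integrable_sq
  calc ∫ ω, (A ω + B ω) ^ 2 ∂μ
      ≤ ∫ ω, ((1 + b / a) * A ω ^ 2 + (1 + a / b) * B ω ^ 2) ∂μ := by
        refine integral_mono (hA.add hB).integrable_sq ((iA.const_mul _).add (iB.const_mul _)) ?_
        intro ω
        have : (1 + b / a) * A ω ^ 2 + (1 + a / b) * B ω ^ 2 - (A ω + B ω) ^ 2 =
            (b * A ω - a * B ω) ^ 2 / (a * b) := by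
          field_simp
          ring
        have h2 : 0 ≤ (b * A ω - a * B ω) ^ 2 / (a * b) := by positivity
        linarith
    _ = (1 + b / a) * ∫ ω, A ω ^ 2 ∂μ + (1 + a / b) * ∫ ω, B ω ^ 2 ∂μ := by
        rw [integral_add (iA.const_mul _) (iB.const_mul _), integral_const_mul, integral_const_mul]
    _ ≤ (1 + b / a) * a ^ 2 + (1 + a / b) * b ^ 2 :=
        add_le_add (mul_le_mul_of_nonneg_left hA2 (by positivity))
          (mul_le_mul_of_nonneg_left hB2 (by positivity))
    _ = (a + b) ^ 2 := by field_simp; ring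

lemma integral_normalizedField_sub_sq_le (hX : ∀ t, MemLp (X t) 2 μ)
    (hself : IsSelfSimilar μ X H₁ H₂) (hstat : HasStationaryRectIncrements μ X)
    (hnorm : ∫ ω, X (1, 1) ω ^ 2 ∂μ = 1) (hH₁ : 0 < H₁) (hH₂ : 0 < H₂) {c s t : ℝ≥0 × ℝ≥0}
    {r₁ r₂ : ℝ} (hc₁ : 0 < c.1) (hc₂ : 0 < c.2) (hr₁ : 0 < r₁) (hr₂ : 0 < r₂) (hs : c ≤ s)
    (ht : c ≤ t) (h1 : |(t.1 : ℝ) - s.1| ≤ c.1 * r₁) (h2 : |(t.2 : ℝ) - s.2| ≤ c.2 * r₂) :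
    ∫ ω, (normalizedField X H₁ H₂ t ω - normalizedField X H₁ H₂ s ω) ^ 2 ∂μ
      ≤ (r₁ ^ H₁ + r₂ ^ H₂) ^ 2 := by
  have hY : ∀ t, MemLp (normalizedField X H₁ H₂ t) 2 μ := fun t => (hX t).const_mul _
  have := integral_add_sq_le ((hY (t.1, t.2)).sub (hY (s.1, t.2)))
    ((hY (s.1, t.2)).sub (hY (s.1, s.2))) (Real.rpow_pos_of_pos hr₁ H₁)
    (Real.rpow_pos_of_pos hr₂ H₂)
    (integral_normalizedField_sub_sq_fst_le hX hself hstat hnorm hH₁ hH₂ hc₁ hr₁ hs.1 ht.1 h1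
      (hc₂.trans_le ht.2))
    (integral_normalizedField_sub_sq_snd_le hX hself hstat hnorm hH₁ hH₂ hc₂ hr₂ hs.2 ht.2 h2
      (hc₁.trans_le hs.1))
  simpa using this

end Moments

/-! ### Nets of intervals and their cardinality -/

lemma exists_interval_net {c d : ℝ≥0} (hcd : c ≤ d) {r : ℝ} (hr : 0 < r) :
    ∃ A : Finset (Set.Icc c d), (A.card : ℝ) ≤ ((d : ℝ) - c) / (2 * r) + 1 ∧
      ∀ t : Set.Icc c d, ∃ s ∈ A, |((t : ℝ≥0) : ℝ) - ((s : ℝ≥0) : ℝ)| ≤ r := by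
  classical
  have hcdR : (c : ℝ) ≤ d := by exact_mod_cast hcd
  -- The net consists of midpoints of consecutive intervals of length `2 r`, clipped at `d`.
  have hmem : ∀ j : ℕ, Real.toNNReal (min (c + (2 * j + 1) * r) d) ∈ Set.Icc c d := fun j => by
    have h0 : (0 : ℝ) ≤ (2 * j + 1) * r := by positivity
    refine ⟨NNReal.le_toNNReal_of_coe_le (le_min (by linarith) hcdR), ?_⟩
    exact Real.toNNReal_le_iff_le_coe.mpr (min_le_right _ _)
  refine ⟨(Finset.range (⌊((d : ℝ) - c) / (2 * r)⌋₊ + 1)).image fun j => ⟨_, hmem j⟩, ?_, ?_⟩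
  · refine (Nat.cast_le.mpr Finset.card_image_le).trans ?_
    rw [Finset.card_range]
    push_cast
    have := Nat.floor_le (a := ((d : ℝ) - c) / (2 * r)) (by
      have : 0 ≤ (d : ℝ) - c := by linarith
      positivity)
    linarith
  · rintro ⟨t, htc, htd⟩
    have htcR : (c : ℝ) ≤ t := by exact_mod_cast htc
    have htdR : (t : ℝ) ≤ d := by exact_mod_cast htd
    have hq : 0 ≤ ((t : ℝ) - c) / (2 * r) := div_nonneg (by linarith) (by linarith)
    refine ⟨_, Finset.mem_image_of_mem _ (a := ⌊((t : ℝ) - c) / (2 * r)⌋₊) ?_, ?_⟩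
    · rw [Finset.mem_range, Nat.lt_succ_iff]
      exact Nat.floor_le_floor (div_le_div_of_nonneg_right (by linarith) (by linarith))
    · set j := ⌊((t : ℝ) - c) / (2 * r)⌋₊
      have h1 : (j : ℝ) * (2 * r) ≤ t - c := (le_div_iff₀ (by linarith)).mp (Nat.floor_le hq)
      have h2 : (t : ℝ) - c < (j + 1) * (2 * r) :=
        (div_lt_iff₀ (by linarith)).mp (Nat.lt_floor_add_one _)
      have h0 : (0 : ℝ) ≤ (2 * j + 1) * r := by positivity
      have hco : ((Real.toNNReal (min (c + (2 * j + 1) * r) d) : ℝ≥0) : ℝ) =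
          min (c + (2 * j + 1) * r) d :=
        Real.coe_toNNReal _ (le_min (add_nonneg c.coe_nonneg h0) d.coe_nonneg)
      simp only [hco]
      rw [abs_le]
      rcases min_cases ((c : ℝ) + (2 * j + 1) * r) d with ⟨h, h'⟩ | ⟨h, h'⟩ <;> rw [h] <;>
        constructor <;> nlinarith

/-- With `a = R ^ (1 / H)` and `V = v ^ (-(1 / H)) ≥ 1`, the left side is at most `(a + 1) V / 2 +
V`. This is where the `+ 3` in `N₁` and `N₂` is spent. -/
lemma interval_net_card_le {H R v : ℝ} (hH : 0 < H) (hR : 0 < R) (hv0 : 0 < v) (hv1 : v ≤ 1) :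
    (1 + 1 / (R ^ (1 / H) + 3)) / (2 * (v / R) ^ (1 / H)) + 1 ≤
      (R ^ (1 / H) + 3) / 2 * v ^ (-(1 / H)) := by
  set a := R ^ (1 / H) with ha
  have ha0 : 0 < a := Real.rpow_pos_of_pos hR _
  have hV : 1 ≤ v ^ (-(1 / H)) :=
    Real.one_le_rpow_of_pos_of_le_one_of_nonpos hv0 hv1 (by
      have : 0 < 1 / H := one_div_pos.mpr hH
      linarith)
  set V := v ^ (-(1 / H)) with hVdef
  have hr : (v / R) ^ (1 / H) = V⁻¹ / a := by
    rw [Real.div_rpow hv0.le hR.le, hVdef, Real.rpow_neg hv0.le, inv_inv]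
  have hV0 : 0 < V := by linarith
  rw [hr]
  have e : (1 + 1 / (a + 3)) / (2 * (V⁻¹ / a)) = (1 + 1 / (a + 3)) * a / 2 * V := by
    field_simp
  have h1 : (1 + 1 / (a + 3)) * a ≤ a + 1 := by
    have : 1 / (a + 3) * a ≤ 1 := by
      rw [one_div_mul_eq_div, div_le_one (by linarith)]
      linarith
    linarith
  rw [e]
  nlinarith [mul_le_mul_of_nonneg_right h1 hV0.le]

lemma constN₁_ge {H₁ H₂ : ℝ} (hH₁ : 0 < H₁) (hH₂ : 0 < H₂) : 3 ≤ constN₁ H₁ H₂ := by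
  have : 0 ≤ ((H₁ + H₂) / H₂) ^ (1 / H₁) := by positivity
  unfold constN₁
  linarith

lemma constN₂_ge {H₁ H₂ : ℝ} (hH₁ : 0 < H₁) (hH₂ : 0 < H₂) : 3 ≤ constN₂ H₁ H₂ := by
  have : 0 ≤ ((H₁ + H₂) / H₁) ^ (1 / H₂) := by positivity
  unfold constN₂
  linarith

/-! ### The tail bound on one rectangle -/

section Block

variable {Ω : Type*} [MeasurableSpace Ω] {μ : Measure Ω} {X : ℝ≥0 × ℝ≥0 → Ω → ℝ} {H₁ H₂ : ℝ}

lemma isGaussianProcess_normalizedField (hgauss : IsGaussianProcess X μ) :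
    IsGaussianProcess (normalizedField X H₁ H₂) μ :=
  hgauss.smul fun t => (fieldScale H₁ H₂ t)⁻¹

lemma integral_normalizedField (hcentered : ∀ t, ∫ ω, X t ω ∂μ = 0) (t : ℝ≥0 × ℝ≥0) :
    ∫ ω, normalizedField X H₁ H₂ t ω ∂μ = 0 := by
  simp only [normalizedField, integral_const_mul, hcentered, mul_zero]

/-- Entropy bound for the normalized field over a finite subset of the rectangle `[c, d]`. -/
theorem measure_exists_lt_abs_normalizedField_le (hgauss : IsGaussianProcess X μ)
    (hcentered : ∀ t, ∫ ω, X t ω ∂μ = 0) (hself : IsSelfSimilar μ X H₁ H₂)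
    (hstat : HasStationaryRectIncrements μ X) (hnorm : ∫ ω, X (1, 1) ω ^ 2 ∂μ = 1)
    (hH₁ : 0 < H₁) (hH₂ : 0 < H₂) {c d : ℝ≥0 × ℝ≥0} (hc₁ : 0 < c.1) (hc₂ : 0 < c.2) (hcd : c ≤ d)
    (hd₁ : (d.1 : ℝ) - c.1 ≤ c.1 * (1 + 1 / constN₁ H₁ H₂))
    (hd₂ : (d.2 : ℝ) - c.2 ≤ c.2 * (1 + 1 / constN₂ H₁ H₂))
    {p : ℝ} (hp0 : 0 < p) (hp1 : p < 1) {u : ℝ} (hu : 0 < u) (F : Finset (ℝ≥0 × ℝ≥0))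
    (hF : ∀ t ∈ F, t ∈ Set.Icc c d) :
    μ {ω | ∃ t ∈ F, u < |normalizedField X H₁ H₂ t ω|} ≤
      ENNReal.ofReal (2 * Real.exp (-(u ^ 2 * (1 - p) ^ 2 / 2)) *
        (constN₁ H₁ H₂ * constN₂ H₁ H₂ / 4 * (Real.exp 1 / p) ^ expQ H₁ H₂)) := by
  classical
  have hX : ∀ t, MemLp (X t) 2 μ := fun t => (hgauss.hasGaussianLaw_eval t).memLp_two
  have hXm : ∀ t, AEMeasurable (X t) μ := fun t => (hX t).aestronglyMeasurable.aemeasurable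
  have hYg : IsGaussianProcess (normalizedField X H₁ H₂) μ :=
    isGaussianProcess_normalizedField hgauss
  have hY0 := fun t => integral_normalizedField (H₁ := H₁) (H₂ := H₂) hcentered t
  have hYi : ∀ t, Integrable (normalizedField X H₁ H₂ t) μ := fun t =>
    (hYg.hasGaussianLaw_eval t).integrable
  have hN₁ := constN₁_ge hH₁ hH₂
  have hN₂ := constN₂_ge hH₁ hH₂
  let e : Set.Icc c.1 d.1 × Set.Icc c.2 d.2 → ℝ≥0 × ℝ≥0 := fun t => (t.1, t.2)
  have he : ∀ t, c ≤ e t := fun t => ⟨t.1.2.1, t.2.2.1⟩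
  have hmain := measure_exists_lt_abs_le_of_covering (μ := μ)
    (Y := fun t => normalizedField X H₁ H₂ (e t))
    (N := constN₁ H₁ H₂ * constN₂ H₁ H₂ / 4) (Q := expQ H₁ H₂)
    (fun t => hYg.aemeasurable (e t)) ?_ ?_ ?_ ?_ hp0 hp1 hu
    (F.attach.image fun t => (⟨t.1.1, (hF t.1 t.2).1.1, (hF t.1 t.2).2.1⟩,
      ⟨t.1.2, (hF t.1 t.2).1.2, (hF t.1 t.2).2.2⟩))
  · refine (measure_mono ?_).trans hmain
    rintro ω ⟨t, ht, hut⟩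
    exact ⟨_, Finset.mem_image_of_mem _ (Finset.mem_attach F ⟨t, ht⟩), hut⟩
  · intro t k
    have h1 : 0 < (e t).1 := hc₁.trans_le (he t).1
    have h2 : 0 < (e t).2 := hc₂.trans_le (he t).2
    have hv : ∫ ω, normalizedField X H₁ H₂ (e t) ω ^ 2 ∂μ ≤ 1 ^ 2 := by
      simp only [normalizedField, mul_pow, integral_const_mul]
      rw [integral_sq_eq_fieldScale_sq hXm hself hnorm h1 h2, ← mul_pow,
        inv_mul_cancel₀ (fieldScale_pos H₁ H₂ h1 h2).ne']
    simpa using lintegral_exp_mul_le_of_hasGaussianLaw (hYg.hasGaussianLaw_eval (e t)) (hY0 _) hv k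
  · nlinarith
  · unfold expQ
    positivity
  · intro v hv0 hv1
    -- The radii split the scale: `r₁ ^ H₁ = v H₂ / (H₁ + H₂)` and `r₂ ^ H₂ = v H₁ / (H₁ + H₂)` add
    -- up to `v`.
    set r₁ : ℝ := (v / ((H₁ + H₂) / H₂)) ^ (1 / H₁) with hr₁def
    set r₂ : ℝ := (v / ((H₁ + H₂) / H₁)) ^ (1 / H₂) with hr₂def
    have hr₁ : 0 < r₁ := by positivity
    have hr₂ : 0 < r₂ := by positivity
    have hc₁' : (0 : ℝ) < c.1 := by exact_mod_cast hc₁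
    have hc₂' : (0 : ℝ) < c.2 := by exact_mod_cast hc₂
    obtain ⟨A₁, hA₁, hA₁'⟩ := exists_interval_net hcd.1 (mul_pos hc₁' hr₁)
    obtain ⟨A₂, hA₂, hA₂'⟩ := exists_interval_net hcd.2 (mul_pos hc₂' hr₂)
    have hcard : ∀ {c d r N V n : ℝ}, 0 < c → 0 < r → d - c ≤ c * (1 + 1 / N) →
        n ≤ (d - c) / (2 * (c * r)) + 1 → (1 + 1 / N) / (2 * r) + 1 ≤ N / 2 * V →
        n ≤ N / 2 * V := by
      intro c d r N V n hc hr h1 h2 h3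
      refine h2.trans (le_trans ?_ h3)
      have : (d - c) / (2 * (c * r)) ≤ (1 + 1 / N) / (2 * r) := by
        rw [div_le_div_iff₀ (by positivity) (by positivity)]
        nlinarith
      linarith
    have hB₁ := hcard hc₁' hr₁ hd₁ hA₁
      (interval_net_card_le hH₁ (R := (H₁ + H₂) / H₂) (by positivity) hv0 hv1)
    have hB₂ := hcard hc₂' hr₂ hd₂ hA₂
      (interval_net_card_le hH₂ (R := (H₁ + H₂) / H₁) (by positivity) hv0 hv1)
    refine ⟨A₁ ×ˢ A₂, ?_, ?_⟩
    · rw [Finset.card_product]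
      push_cast
      calc (A₁.card : ℝ) * A₂.card ≤ (constN₁ H₁ H₂ / 2 * v ^ (-(1 / H₁))) *
            (constN₂ H₁ H₂ / 2 * v ^ (-(1 / H₂))) :=
            mul_le_mul hB₁ hB₂ (Nat.cast_nonneg _) (by positivity)
        _ = constN₁ H₁ H₂ * constN₂ H₁ H₂ / 4 * (v ^ (-(1 / H₁)) * v ^ (-(1 / H₂))) := by ring
        _ = _ := by
          rw [← Real.rpow_add hv0, expQ, neg_add]
    · rintro ⟨t₁, t₂⟩
      obtain ⟨s₁, hs₁, hs₁'⟩ := hA₁' t₁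
      obtain ⟨s₂, hs₂, hs₂'⟩ := hA₂' t₂
      refine ⟨(s₁, s₂), Finset.mem_product.mpr ⟨hs₁, hs₂⟩, fun k => ?_⟩
      refine lintegral_exp_mul_le_of_hasGaussianLaw (v := v) (hYg.hasGaussianLaw_fun_sub
        (s := e (t₁, t₂)) (t := e (s₁, s₂))) ?_ ?_ k
      · rw [integral_sub (hYi _) (hYi _), hY0, hY0, sub_zero]
      · refine (integral_normalizedField_sub_sq_le hX hself hstat hnorm hH₁ hH₂ hc₁ hc₂ hr₁ hr₂
          (he (s₁, s₂)) (he (t₁, t₂)) hs₁' hs₂').trans_eq ?_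
        rw [hr₁def, hr₂def, ← Real.rpow_mul (by positivity), ← Real.rpow_mul (by positivity),
          one_div_mul_cancel hH₁.ne', one_div_mul_cancel hH₂.ne', Real.rpow_one, Real.rpow_one]
        congr 1
        field_simp
        ring

/-- Continuity from below along an enumeration: a bound uniform over finite subsets passes to `S`
without loss. -/
lemma measure_exists_mem_countable_le {T : Type*} {S : Set T} (hS : S.Countable) (P : T → Ω → Prop)
    {B : ENNReal} (h : ∀ F : Finset T, ↑F ⊆ S → μ {ω | ∃ t ∈ F, P t ω} ≤ B) :
    μ {ω | ∃ t ∈ S, P t ω} ≤ B := by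
  classical
  rcases S.eq_empty_or_nonempty with rfl | hne
  · simp
  obtain ⟨f, rfl⟩ := hS.exists_eq_range hne
  have e : {ω | ∃ t ∈ Set.range f, P t ω} = ⋃ n : ℕ, {ω | P (f n) ω} := by
    ext ω
    simp
  rw [e, measure_iUnion_eq_iSup_accumulate]
  refine iSup_le fun n => le_trans (measure_mono ?_) (h ((Finset.range (n + 1)).image f) ?_)
  · intro ω hω
    obtain ⟨m, hm, hP⟩ := Set.mem_accumulate.mp hω
    exact ⟨f m, Finset.mem_image_of_mem _ (Finset.mem_range.mpr (by omega)), hP⟩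
  · intro t ht
    obtain ⟨m, -, rfl⟩ := Finset.mem_image.mp (Finset.mem_coe.mp ht)
    exact ⟨m, rfl⟩

lemma two_le_expQ (hH₁ : H₁ ∈ Set.Ioo (0 : ℝ) 1) (hH₂ : H₂ ∈ Set.Ioo (0 : ℝ) 1) :
    2 ≤ expQ H₁ H₂ := by
  have h1 := one_le_one_div hH₁.1 hH₁.2.le
  have h2 := one_le_one_div hH₂.1 hH₂.2.le
  unfold expQ
  linarith

/-- Here `p = 2 / u²`. Replacing `(1 - p)²` by 1 in the exponent costs at most `e² ≤ 8`, and `Q ≥ 2`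
gives `2 ^ (-Q) ≤ 1 / 4`; the numerical factors `2 · 8 · (1 / 4) · (1 / 4)` multiply to exactly 1.
-/
lemma entropy_bound_le (hH₁ : H₁ ∈ Set.Ioo (0 : ℝ) 1) (hH₂ : H₂ ∈ Set.Ioo (0 : ℝ) 1) {u : ℝ}
    (hu : 0 < u) :
    2 * Real.exp (-(u ^ 2 * (1 - 2 / u ^ 2) ^ 2 / 2)) *
        (constN₁ H₁ H₂ * constN₂ H₁ H₂ / 4 * (Real.exp 1 / (2 / u ^ 2)) ^ expQ H₁ H₂) ≤
      constC₁ H₁ H₂ * u ^ (2 * expQ H₁ H₂) * Real.exp (-(u ^ 2 / 2)) := by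
  have hQ := two_le_expQ hH₁ hH₂
  set Q := expQ H₁ H₂ with hQdef
  have hN₁ := constN₁_ge hH₁.1 hH₂.1
  have hN₂ := constN₂_ge hH₁.1 hH₂.1
  set P := constN₁ H₁ H₂ * constN₂ H₁ H₂ with hP
  have hP0 : 0 < P := by positivity
  have e1 : (Real.exp 1 / (2 / u ^ 2)) ^ Q = Real.exp Q * u ^ (2 * Q) * (2 ^ Q)⁻¹ := by
    rw [show Real.exp 1 / (2 / u ^ 2) = Real.exp 1 * u ^ 2 / 2 by field_simp,
      Real.div_rpow (by positivity) (by norm_num), Real.mul_rpow (Real.exp_pos _).le (by positivity),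
      ← Real.exp_mul, one_mul, Real.rpow_mul hu.le, Real.rpow_two]
    rfl
  have e2 : ((2 : ℝ) ^ Q)⁻¹ ≤ 1 / 4 := by
    have h4 : (2 : ℝ) ^ (2 : ℝ) ≤ 2 ^ Q := Real.rpow_le_rpow_of_exponent_le (by norm_num) hQ
    rw [Real.rpow_two] at h4
    rw [inv_le_comm₀ (by positivity) (by norm_num)]
    linarith
  have e3 : Real.exp (-(u ^ 2 * (1 - 2 / u ^ 2) ^ 2 / 2)) ≤ 8 * Real.exp (-(u ^ 2 / 2)) := by
    have h8 : Real.exp 2 ≤ 8 := by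
      have h := Real.exp_one_lt_d9
      have : Real.exp 2 = Real.exp 1 ^ 2 := by rw [← Real.exp_nat_mul]; norm_num
      rw [this]
      nlinarith [Real.exp_pos 1]
    calc Real.exp (-(u ^ 2 * (1 - 2 / u ^ 2) ^ 2 / 2)) ≤ Real.exp (2 + -(u ^ 2 / 2)) := by
          apply Real.exp_le_exp.mpr
          have : u ^ 2 * (1 - 2 / u ^ 2) ^ 2 = u ^ 2 - 4 + 4 / u ^ 2 := by
            field_simp
            ring
          rw [this]
          have : 0 ≤ 4 / u ^ 2 := by positivity
          linarith
      _ ≤ _ := by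
          rw [Real.exp_add]
          exact mul_le_mul_of_nonneg_right h8 (Real.exp_pos _).le
  have e4 : P * Real.exp Q ≤ constC₁ H₁ H₂ := by
    unfold constC₁
    refine mul_le_mul_of_nonneg_left (Real.exp_le_exp.mpr ?_) hP0.le
    have : 0 ≤ 1 / (2 * ((4 : ℝ) ^ (H₁ + H₂) + 1)) := by positivity
    linarith
  have hU : 0 < u ^ (2 * Q) := Real.rpow_pos_of_pos hu _
  rw [e1]
  calc 2 * Real.exp (-(u ^ 2 * (1 - 2 / u ^ 2) ^ 2 / 2)) *
        (P / 4 * (Real.exp Q * u ^ (2 * Q) * (2 ^ Q)⁻¹))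
      ≤ 2 * (8 * Real.exp (-(u ^ 2 / 2))) *
        (P / 4 * (Real.exp Q * u ^ (2 * Q) * (1 / 4))) := by gcongr
    _ = P * Real.exp Q * (u ^ (2 * Q) * Real.exp (-(u ^ 2 / 2))) := by ring
    _ ≤ constC₁ H₁ H₂ * (u ^ (2 * Q) * Real.exp (-(u ^ 2 / 2))) :=
        mul_le_mul_of_nonneg_right e4 (by positivity)
    _ = _ := by ring

end Block

/-! ### Splitting the Gaussian exponent -/

/-- Since `A ≥ 4`, the worst case is `r = 1`. There `A ≥ 4 s` reduces the claim to `s (1 - C) ≥ 1`,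
and `s C = 1 / y²` makes this `1 / y² + 1 ≤ s`. It holds because `y s ≥ 4.6` and `1 + y² ≤ 4.6 y` on
`[1, 4]`. -/
lemma exponent_le {y k A r : ℝ} (hy1 : 1 ≤ y) (hy4 : y ≤ 4) (hk : 69 / 10 ≤ k)
    (hA : 4 * (2 / (y * 3) * k) ≤ A) (hr : 1 ≤ r) :
    A / 2 * (3 / (2 * y * k)) + 2 * r ≤ A * r / 2 := by
  have hy0 : 0 < y := by linarith
  have hk0 : 0 < k := by linarith
  set s := 2 / (y * 3) * k with hs
  set C := 3 / (2 * y * k) with hC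
  have hsC : s * C = 1 / y ^ 2 := by
    rw [hs, hC]
    field_simp
  have hs0 : 0 < s := by positivity
  have hys : 46 / 10 ≤ y * s := by
    have : y * s = 2 / 3 * k := by
      rw [hs]
      field_simp
    rw [this]
    linarith
  have hs1 : 1 ≤ s := by nlinarith
  have hC1 : C ≤ 1 := by
    rw [hC, div_le_one (by positivity)]
    nlinarith
  have hkey : 1 / y ^ 2 + 1 ≤ s := by
    have h : 1 + y ^ 2 ≤ y ^ 2 * s := by nlinarith
    have : 1 / y ^ 2 + 1 = (1 + y ^ 2) / y ^ 2 := by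
      field_simp
    rw [this, div_le_iff₀ (by positivity)]
    linarith
  have h1 : 2 ≤ A / 2 * (1 - C) := by nlinarith
  nlinarith

/-- By AM-GM the minimum is `2 √12 ≈ 6.928`, just above `6.9`. -/
lemma const_ge {z : ℝ} (hz : 0 < z) : 69 / 10 ≤ z * 3 + 4 / z := by
  have : z * 3 + 4 / z - 69 / 10 = (3 * z ^ 2 + 4 - 69 / 10 * z) / z := by
    field_simp
  have h2 : 0 ≤ (3 * z ^ 2 + 4 - 69 / 10 * z) / z :=
    div_nonneg (by nlinarith [sq_nonneg (z - 115 / 100)]) hz.le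
  linarith

/-- Applied with `f = φ(1, 1)` and `g = φ(2ⁿ, 2ᵐ)`: the term `2 g² / f²` is the exponent in the
series. The second bound keeps `p = 2 / u²` at most `1 / 2`. -/
lemma exponent_bound {H₁ H₂ : ℝ} (hH₁ : H₁ ∈ Set.Ioo (0 : ℝ) 1) (hH₂ : H₂ ∈ Set.Ioo (0 : ℝ) 1)
    {f g ε : ℝ} (hf : 0 < f) (hfg : f ≤ g)
    (hε : 2 / f * Real.sqrt (2 / ((4 : ℝ) ^ (max H₁ H₂) * 3) *
      ((4 : ℝ) ^ (min H₁ H₂) * 3 + (4 : ℝ) ^ (1 - min H₁ H₂))) < ε) :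
    ε ^ 2 / 2 * f ^ 2 * constC₂ H₁ H₂ + 2 * (g ^ 2 / f ^ 2) ≤ (ε * g) ^ 2 / 2 ∧
      4 ≤ (ε * g) ^ 2 := by
  have hm0 : 0 < max H₁ H₂ := lt_max_of_lt_left hH₁.1
  have hm1 : max H₁ H₂ ≤ 1 := max_le hH₁.2.le hH₂.2.le
  set y : ℝ := (4 : ℝ) ^ (max H₁ H₂) with hy
  set z : ℝ := (4 : ℝ) ^ (min H₁ H₂) with hz
  have hz0 : 0 < z := by positivity
  have hy1 : 1 ≤ y := Real.one_le_rpow (by norm_num) hm0.le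
  have hy4 : y ≤ 4 := by
    simpa using Real.rpow_le_rpow_of_exponent_le (x := (4 : ℝ)) (by norm_num) hm1
  have hzz : (4 : ℝ) ^ (1 - min H₁ H₂) = 4 / z := by
    rw [Real.rpow_sub (by norm_num), Real.rpow_one]
  rw [hzz] at hε
  have hC : constC₂ H₁ H₂ = 3 / (2 * y * (z * 3 + 4 / z)) := by
    rw [constC₂, hzz, mul_comm 3]
  have hk := const_ge hz0
  set k := z * 3 + 4 / z with hkdef
  set s := 2 / (y * 3) * k with hs
  have hs0 : 0 ≤ s := by positivity
  have hA : 4 * s ≤ (ε * f) ^ 2 := by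
    have h1 : 2 * Real.sqrt s ≤ ε * f := by
      have := mul_le_mul_of_nonneg_right hε.le hf.le
      have e : 2 / f * Real.sqrt s * f = 2 * Real.sqrt s := by field_simp
      linarith
    have h2 := pow_le_pow_left₀ (by positivity) h1 2
    rw [mul_pow, Real.sq_sqrt hs0] at h2
    linarith
  have hr : 1 ≤ g ^ 2 / f ^ 2 := by
    rw [one_le_div (by positivity)]
    exact pow_le_pow_left₀ hf.le hfg 2
  have h := exponent_le hy1 hy4 hk hA hr
  have e : (ε * f) ^ 2 * (g ^ 2 / f ^ 2) = (ε * g) ^ 2 := by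
    field_simp
  rw [e] at h
  refine ⟨by rw [hC]; linarith, ?_⟩
  have hs1 : 1 ≤ s := by
    rw [hs, div_mul_eq_mul_div, one_le_div (by positivity)]
    linarith
  rw [← e]
  nlinarith

/-! ### Separability and dyadic blocks -/

/-- By separability, exceedance at a point of an open set `G` is witnessed in `S ∩ G`. -/
lemma exists_mem_lt_abs_normalizedField {Ω : Type*} {X : ℝ≥0 × ℝ≥0 → Ω → ℝ} {H₁ H₂ : ℝ}
    (hH₁ : 0 < H₁) (hH₂ : 0 < H₂) {A S : Set (ℝ≥0 × ℝ≥0)} {ω : Ω}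
    (hsep : ∀ G, IsOpen G → ∀ t ∈ A ∩ G, X t ω ∈ closure ((fun s => X s ω) '' (S ∩ G)))
    (hSpos : ∀ s ∈ S, 0 < s.1 ∧ 0 < s.2) {G : Set (ℝ≥0 × ℝ≥0)} (hG : IsOpen G) {t : ℝ≥0 × ℝ≥0}
    (htA : t ∈ A) (htG : t ∈ G) {u : ℝ} (hu : u * fieldScale H₁ H₂ t < |X t ω|) :
    ∃ s ∈ S ∩ G, u < |normalizedField X H₁ H₂ s ω| := by
  obtain ⟨m, hm1, hm2⟩ := exists_between hu
  have hcont : Continuous fun s : ℝ≥0 × ℝ≥0 => u * fieldScale H₁ H₂ s := by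
    unfold fieldScale
    refine continuous_const.mul (Continuous.mul ?_ ?_)
    · exact (NNReal.continuous_coe.comp continuous_fst).rpow_const fun _ => Or.inr hH₁.le
    · exact (NNReal.continuous_coe.comp continuous_snd).rpow_const fun _ => Or.inr hH₂.le
  -- Separability controls values of `X`, not of the normalized field. Shrinking `G` to where the
  -- continuous threshold stays below `m` transfers the strict inequality to `s`.
  have hG' : IsOpen (G ∩ {s | u * fieldScale H₁ H₂ s < m}) :=
    hG.inter (isOpen_lt hcont continuous_const)
  have hcl := hsep _ hG' t ⟨htA, htG, hm1⟩
  obtain ⟨x, hx, s, ⟨hsS, hsG, hsm⟩, rfl⟩ := mem_closure_iff.mp hcl {x | m < |x|}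
    (isOpen_lt continuous_const continuous_abs) hm2
  have hpos := fieldScale_pos H₁ H₂ (hSpos s hsS).1 (hSpos s hsS).2
  refine ⟨s, ⟨hsS, hsG⟩, ?_⟩
  have h1 : u * fieldScale H₁ H₂ s < |X s ω| := lt_trans hsm hx
  rw [normalizedField, abs_mul, abs_inv, abs_of_pos hpos, inv_mul_eq_div, lt_div_iff₀ hpos]
  exact h1

/-- The lower corner of the rectangle slightly larger than the dyadic block with index `k`. -/
noncomputable def blockLower (H₁ H₂ : ℝ) (k : ℕ × ℕ) : ℝ≥0 × ℝ≥0 :=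
  (2 ^ (k.1 + 1) / (2 + 1 / (constN₁ H₁ H₂).toNNReal),
    2 ^ (k.2 + 1) / (2 + 1 / (constN₂ H₁ H₂).toNNReal))

/-- The upper corner of the dyadic block with index `k`. -/
def blockUpper (k : ℕ × ℕ) : ℝ≥0 × ℝ≥0 := (2 ^ (k.1 + 1), 2 ^ (k.2 + 1))

/-- The corner solves `d - c = c (1 + 1 / N)` with `d = 2 ^ (n + 1)`, the largest side the net count
allows. It lies strictly below `2 ^ n`, leaving room for an open neighbourhood of the block. -/
lemma blockLower_coord {N : ℝ} (hN : 3 ≤ N) (n : ℕ) :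
    0 < (2 ^ (n + 1) / (2 + 1 / N.toNNReal) : ℝ≥0) ∧
    (2 ^ (n + 1) / (2 + 1 / N.toNNReal) : ℝ≥0) < 2 ^ n ∧
    ((2 ^ (n + 1) : ℝ≥0) : ℝ) - ((2 ^ (n + 1) / (2 + 1 / N.toNNReal) : ℝ≥0) : ℝ) ≤
      ((2 ^ (n + 1) / (2 + 1 / N.toNNReal) : ℝ≥0) : ℝ) * (1 + 1 / N) := by
  have hN0 : 0 < N.toNNReal := Real.toNNReal_pos.mpr (by linarith)
  have hNN : 0 < N := by linarith
  refine ⟨by positivity, ?_, ?_⟩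
  · rw [div_lt_iff₀ (by positivity), pow_succ]
    have : 0 < 1 / N.toNNReal := by positivity
    exact mul_lt_mul_of_pos_left (lt_add_of_pos_right _ this) (by positivity)
  · push_cast
    rw [Real.coe_toNNReal _ (by linarith)]
    apply le_of_eq
    field_simp
    ring

end GaussField

open GaussField

/-! ### Union over the dyadic blocks -/

theorem mainTheorem7 {Ω : Type*} [MeasurableSpace Ω] (μ : Measure Ω) [IsProbabilityMeasure μ]
    (X : ℝ≥0 × ℝ≥0 → Ω → ℝ) (H₁ H₂ : ℝ)
    (hH₁ : H₁ ∈ Set.Ioo (0 : ℝ) 1) (hH₂ : H₂ ∈ Set.Ioo (0 : ℝ) 1)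
    (hgauss : IsGaussianProcess X μ)
    (hcentered : ∀ t, ∫ ω, X t ω ∂μ = 0)
    (hself : GaussField.IsSelfSimilar μ X H₁ H₂)
    (hstat : GaussField.HasStationaryRectIncrements μ X)
    (hnorm : ∫ ω, X (1, 1) ω ^ 2 ∂μ = 1)
    (hsep : GaussField.IsSeparableOn μ X (Set.Ici (1, 1)))
    (φ : ℝ → ℝ → ℝ)
    (hφpos : ∀ x y, 0 < x → 0 < y → 0 < φ x y)
    (hφmono₁ : ∀ y, 0 < y → MonotoneOn (fun x => φ x y) (Set.Ioi 0))
    (hφmono₂ : ∀ x, 0 < x → MonotoneOn (fun y => φ x y) (Set.Ioi 0))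
    (hseries : Summable (GaussField.seriesTerm H₁ H₂ φ))
    (ε : ℝ)
    (hε : 2 / φ 1 1 * Real.sqrt (2 / ((4 : ℝ) ^ (max H₁ H₂) * 3) *
      ((4 : ℝ) ^ (min H₁ H₂) * 3 + (4 : ℝ) ^ (1 - min H₁ H₂))) < ε) :
    GaussField.tailY μ X H₁ H₂ φ ε ≤
      GaussField.constC₁ H₁ H₂ * ε ^ (2 * GaussField.expQ H₁ H₂) *
        Real.exp (-(ε ^ 2 / 2) * φ 1 1 ^ 2 * GaussField.constC₂ H₁ H₂) *
        ∑' k : ℕ × ℕ, GaussField.seriesTerm H₁ H₂ φ k := by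
  have hφ11 : 0 < φ 1 1 := hφpos 1 1 one_pos one_pos
  have hε0 : 0 < ε := lt_of_le_of_lt (by positivity) hε
  have hN₁ := constN₁_ge hH₁.1 hH₂.1
  have hN₂ := constN₂_ge hH₁.1 hH₂.1
  have hφle : ∀ {a b x y : ℝ}, 0 < a → 0 < b → a ≤ x → b ≤ y → φ a b ≤ φ x y :=
    fun {a b x y} ha hb hx hy =>
      (hφmono₁ b hb ha (ha.trans_le hx) hx).trans
        (hφmono₂ x (ha.trans_le hx) hb (hb.trans_le hy) hy)
  set c : ℝ := constC₁ H₁ H₂ * ε ^ (2 * expQ H₁ H₂) *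
    Real.exp (-(ε ^ 2 / 2) * φ 1 1 ^ 2 * constC₂ H₁ H₂) with hc
  have hC₁ : 0 ≤ constC₁ H₁ H₂ := by unfold constC₁; positivity
  have hc0 : 0 ≤ c := by positivity
  have hterm0 : ∀ k, 0 ≤ seriesTerm H₁ H₂ φ k := fun k => by
    have := hφpos (2 ^ k.1) (2 ^ k.2) (by positivity) (by positivity)
    unfold seriesTerm
    positivity
  obtain ⟨S, hSA, hScount, hSae⟩ := hsep
  have hSpos : ∀ s ∈ S, 0 < s.1 ∧ 0 < s.2 := fun s hs =>
    ⟨one_pos.trans_le (hSA hs).1, one_pos.trans_le (hSA hs).2⟩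
  set E : ℕ × ℕ → Set Ω := fun k => {ω | ∃ s ∈ S ∩ Set.Icc (blockLower H₁ H₂ k) (blockUpper k),
    ε * φ (2 ^ k.1) (2 ^ k.2) < |normalizedField X H₁ H₂ s ω|} with hE
  have hEbound : ∀ k, μ (E k) ≤ ENNReal.ofReal (c * seriesTerm H₁ H₂ φ k) := by
    intro k
    set g := φ (2 ^ k.1) (2 ^ k.2) with hg
    have hfg : φ 1 1 ≤ g := hφle one_pos one_pos (one_le_pow₀ (by norm_num))
      (one_le_pow₀ (by norm_num))
    have hg0 : 0 < g := hφ11.trans_le hfg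
    obtain ⟨hexp, hu4⟩ := exponent_bound hH₁ hH₂ hφ11 hfg hε
    set u := ε * g with hu
    have hu0 : 0 < u := by positivity
    refine (measure_exists_mem_countable_le (hScount.mono Set.inter_subset_left) _
      (B := ENNReal.ofReal (constC₁ H₁ H₂ * u ^ (2 * expQ H₁ H₂) * Real.exp (-(u ^ 2 / 2))))
      fun F hF => ?_).trans (ENNReal.ofReal_le_ofReal ?_)
    · obtain ⟨a1, a2, a3⟩ := blockLower_coord hN₁ k.1
      obtain ⟨b1, b2, b3⟩ := blockLower_coord hN₂ k.2
      have hle : ∀ n : ℕ, (2 : ℝ≥0) ^ n ≤ 2 ^ (n + 1) := fun n =>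
        pow_le_pow_right₀ (by norm_num) n.le_succ
      refine (measure_exists_lt_abs_normalizedField_le hgauss hcentered hself hstat hnorm hH₁.1
        hH₂.1 (c := blockLower H₁ H₂ k) (d := blockUpper k) a1 b1
        ⟨a2.le.trans (hle _), b2.le.trans (hle _)⟩ a3 b3 (p := 2 / u ^ 2) (by positivity) ?_ hu0 F
        fun t ht => (hF ht).2).trans (ENNReal.ofReal_le_ofReal (entropy_bound_le hH₁ hH₂ hu0))
      rw [div_lt_one (by positivity)]
      linarith
    -- The split exponent produces the denominator of the series term, and `u ^ (2Q) = ε ^ (2Q) g ^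
    -- (2Q)` its numerator.
    · have h1 : Real.exp (-(u ^ 2 / 2)) ≤
          Real.exp (-(ε ^ 2 / 2) * φ 1 1 ^ 2 * constC₂ H₁ H₂) /
            Real.exp (2 * (g ^ 2 / φ 1 1 ^ 2)) := by
        rw [← Real.exp_sub]
        apply Real.exp_le_exp.mpr
        linarith
      have h2 : u ^ (2 * expQ H₁ H₂) = ε ^ (2 * expQ H₁ H₂) * g ^ (2 * expQ H₁ H₂) :=
        Real.mul_rpow hε0.le hg0.le
      calc constC₁ H₁ H₂ * u ^ (2 * expQ H₁ H₂) * Real.exp (-(u ^ 2 / 2))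
          ≤ constC₁ H₁ H₂ * u ^ (2 * expQ H₁ H₂) *
            (Real.exp (-(ε ^ 2 / 2) * φ 1 1 ^ 2 * constC₂ H₁ H₂) /
              Real.exp (2 * (g ^ 2 / φ 1 1 ^ 2))) :=
            mul_le_mul_of_nonneg_left h1 (by positivity)
        _ = _ := by
            rw [h2, hc, seriesTerm]
            ring
  have hcover : ∀ᵐ ω ∂μ, (ε : EReal) < normalizedSup X H₁ H₂ φ ω → ω ∈ ⋃ k, E k := by
    filter_upwards [hSae] with ω hω hlt
    unfold normalizedSup at hlt
    obtain ⟨t, hlt⟩ := lt_iSup_iff.mp hlt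
    obtain ⟨htA, hlt⟩ := lt_iSup_iff.mp hlt
    rw [EReal.coe_lt_coe_iff] at hlt
    obtain ⟨n, hn1, hn2⟩ := exists_nat_pow_near htA.1 (one_lt_two (α := ℝ≥0))
    obtain ⟨m, hm1, hm2⟩ := exists_nat_pow_near htA.2 (one_lt_two (α := ℝ≥0))
    have ht1 : 0 < t.1 := one_pos.trans_le htA.1
    have ht2 : 0 < t.2 := one_pos.trans_le htA.2
    have hscale := fieldScale_pos H₁ H₂ ht1 ht2
    have hφt : φ (2 ^ n) (2 ^ m) ≤ φ t.1 t.2 :=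
      hφle (by positivity) (by positivity) (by exact_mod_cast hn1) (by exact_mod_cast hm1)
    have hφt0 : 0 < φ t.1 t.2 := hφpos _ _ ht1 ht2
    have hex : ε * φ (2 ^ n) (2 ^ m) * fieldScale H₁ H₂ t < |X t ω| := by
      change ε < |X t ω| / (fieldScale H₁ H₂ t * φ t.1 t.2) at hlt
      rw [lt_div_iff₀ (by positivity)] at hlt
      refine lt_of_le_of_lt ?_ hlt
      rw [mul_comm (fieldScale H₁ H₂ t), ← mul_assoc]
      gcongr
    -- The dyadic block contains its lower edges, so an open rectangle around `t` needs the enlarged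
    -- lower corner.
    have htG : t ∈ Set.Ioo (blockLower H₁ H₂ (n, m)).1 (blockUpper (n, m)).1 ×ˢ
        Set.Ioo (blockLower H₁ H₂ (n, m)).2 (blockUpper (n, m)).2 :=
      ⟨⟨(blockLower_coord hN₁ n).2.1.trans_le hn1, hn2⟩,
        ⟨(blockLower_coord hN₂ m).2.1.trans_le hm1, hm2⟩⟩
    obtain ⟨s, ⟨hsS, hsG⟩, hs⟩ := exists_mem_lt_abs_normalizedField hH₁.1 hH₂.1 hω hSpos
      (isOpen_Ioo.prod isOpen_Ioo) htA htG hex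
    exact Set.mem_iUnion.mpr ⟨(n, m), s, ⟨hsS, ⟨hsG.1.1.le, hsG.2.1.le⟩,
      ⟨hsG.1.2.le, hsG.2.2.le⟩⟩, hs⟩
  have hμ : μ {ω | (ε : EReal) < normalizedSup X H₁ H₂ φ ω} ≤
      ENNReal.ofReal (c * ∑' k, seriesTerm H₁ H₂ φ k) := by
    calc μ {ω | (ε : EReal) < normalizedSup X H₁ H₂ φ ω} ≤ μ (⋃ k, E k) := measure_mono_ae hcover
      _ ≤ ∑' k, μ (E k) := measure_iUnion_le _
      _ ≤ ∑' k, ENNReal.ofReal (c * seriesTerm H₁ H₂ φ k) := ENNReal.tsum_le_tsum hEbound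
      _ = _ := by
          rw [← ENNReal.ofReal_tsum_of_nonneg (fun k => mul_nonneg hc0 (hterm0 k))
            (hseries.mul_left c), tsum_mul_left]
  exact ENNReal.toReal_le_of_le_ofReal (mul_nonneg hc0 (tsum_nonneg hterm0)) hμ
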